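/- **Setting.** Fix $H\ge 2$, a probability measure $\mu$ on $\mathbb{R}^d$, basis functions $e_1,e_2,\dots\in L^2(\mu)$, integers $q_n\ge 0$, functions $f_{n1},\dots,f_{nH}\in L^2(\mu)$ and $\sigma_0>0$. For each sample size $n$ let $(X_i,Y_i,Z_i)_{1\le i\le n}$ satisfy $$Y_i=f_{nZ_i}(X_i)+\varepsilon_i,\qquad \varepsilon_1,\dots,\varepsilon_n\mid \mathbf X,\mathbf Z\ \overset{\text{i.i.d.}}{\sim}\ \mathcal N(0,\sigma_0^2),$$ where $X_i\in\mathbb{R}^d$, $Z_i\in\{1,\dots,H\}$, $\mathbf X=(X_1,\dots,X_n)$, $\mathbf Z=(Z_1,\dots,Z_n)$, every $X_i$ has law $\mu$, and the joint law of $(\mathbf X,\mathbf Z)$ is otherwise arbitrary. Put $\boldsymbol Y=(Y_1,\dots,Y_n)^\top$ and $\boldsymbol f=(f_{nZ_1}(X_1),\dots,f_{nZ_n}(X_n))^\top$. Let $\boldsymbol P_{n0}$ and $\boldsymbol P_{n1}$ be the orthogonal projection matrices of $\mathbb{R}^n$ onto the column spaces of the $n\times q_n$ matrix with entries $e_j(X_i)$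 and of the $n\times Hq_n$ matrix with entries $\mathbb 1(Z_i=h)\,e_j(X_i)$, respectively ($1\le j\le q_n$, $1\le h\le H$), and let $p_{n0},p_{n1}$ be their ranks. The F statistic is $$F(\mathbf X,\boldsymbol Y,\mathbf Z)=\frac{\boldsymbol Y^\top(\boldsymbol P_{n1}-\boldsymbol P_{n0})\boldsymbol Y/(p_{n1}-p_{n0})}{\boldsymbol Y^\top(\boldsymbol I_n-\boldsymbol P_{n1})\boldsymbol Y/(n-p_{n1})},$$ and $$\mathrm r(f;q)=\min_{b\in\mathbb{R}^q}\int\Big(f-\sum_{j=1}^q b_je_j\Big)^2\,\mathrm d\mu .$$ *Continuous partial permutation test* with kernel $K_{q_n}(x,x')=\sum_{j=1}^{q_n}e_j(x)e_j(x')$ and permutation size $b=n-p_{n0}$: write the matrix $(K_{q_n}(X_i,X_j))_{i,j}$ as $\boldsymbol\Gamma\boldsymbol C\boldsymbol\Gamma^\top$ with $\boldsymbol\Gamma$ orthogonal and $\boldsymbol C$ diagonal with descending diagonal entries (any such decomposition), let $\boldsymbol W=\boldsymbol\Gamma^\top\boldsymbol Y$, draw $\boldsymbol W^{\mathrm p}$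 uniformly from the set of $\boldsymbol W^*\in\mathbb R^n$ with $W^*_i=W_i$ for $i\le n-b$ and $\sum_{i>n-b}(W^*_i)^2=\sum_{i>n-b}W_i^2$, and put $\boldsymbol Y^{\mathrm p}=\boldsymbol\Gamma\boldsymbol W^{\mathrm p}$. The $p$-value is $$p(\mathbf X,\boldsymbol Y,\mathbf Z)=\Pr\{F(\mathbf X,\boldsymbol Y^{\mathrm p},\mathbf Z)\ge F(\mathbf X,\boldsymbol Y,\mathbf Z)\mid \mathbf X,\boldsymbol Y,\mathbf Z\}.$$ **Theorem.** Let $\theta\ge 0$. Suppose that, as $n\to\infty$, in probability (the ranks are functions of $\mathbf X,\mathbf Z$), $$p_{n1}-p_{n0}\to\infty,\qquad \frac{p_{n1}-p_{n0}}{n-p_{n1}}\to 0,\qquad \frac{n\sum_{h=1}^H \mathrm r(f_{nh};q_n)}{\sqrt{p_{n1}-p_{n0}}}\to 0,$$ where $n-p_{n1}>0$ with probability tending to $1$. Let $\alpha\in(0,1)$, let $\Phi$ be the standard normal distribution function and $z_\alpha$ its $\alpha$-quantile. 1. If $\dfrac{\boldsymbol f^\top(\boldsymbol I_n-\boldsymbol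 P_{n0})\boldsymbol f}{\sigma_0^2\sqrt{p_{n1}-p_{n0}}}=\theta+o_{\Pr}(1)$, then $\Pr\{p(\mathbf X,\boldsymbol Y,\mathbf Z)\le\alpha\}=\Phi(z_\alpha+\theta/\sqrt2)+o(1)$. 2. If $\dfrac{\boldsymbol f^\top(\boldsymbol I_n-\boldsymbol P_{n0})\boldsymbol f}{\sigma_0^2\sqrt{p_{n1}-p_{n0}}}\ge\theta+o_{\Pr}(1)$, then $\Pr\{p(\mathbf X,\boldsymbol Y,\mathbf Z)\le\alpha\}\ge\Phi(z_\alpha+\theta/\sqrt2)+o(1)$. -/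

import Mathlib

open MeasureTheory ProbabilityTheory Filter Topology
open scoped NNReal ENNReal Matrix

noncomputable section

namespace PartialPerm

/-! ### Modes of convergence along a sequence of probability spaces -/

section Convergence

variable {Ω : ℕ → Type*} [∀ n, MeasurableSpace (Ω n)]

/-- `A n = a + o_Pr(1)`; the probability space may change with `n`. -/
def TendstoInPr (P : ∀ n, Measure (Ω n)) (A : ∀ n, Ω n → ℝ) (a : ℝ) : Prop :=
  ∀ ε : ℝ, 0 < ε → Tendsto (fun n => P n {ω | ε ≤ |A n ω - a|}) atTop (𝓝 0)

/-- `A n → ∞` in probability. -/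
def TendstoTopInPr (P : ∀ n, Measure (Ω n)) (A : ∀ n, Ω n → ℝ) : Prop :=
  ∀ M : ℝ, Tendsto (fun n => P n {ω | A n ω ≤ M}) atTop (𝓝 0)

/-- `A n ≥ a + o_Pr(1)`. -/
def GeInPr (P : ∀ n, Measure (Ω n)) (A : ∀ n, Ω n → ℝ) (a : ℝ) : Prop :=
  ∃ R : ∀ n, Ω n → ℝ, TendstoInPr P R 0 ∧ ∀ n ω, a + R n ω ≤ A n ω

end Convergence

/-! ### The standard normal distribution -/

/-- The distribution function of `N(0, 1)`. -/
def stdNormalCDF (x : ℝ) : ℝ := cdf (gaussianReal 0 1) x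

/-- The `α`-quantile `z_α` of `N(0, 1)`, for `0 < α < 1`. -/
def stdNormalQuantile (α : ℝ) : ℝ := sInf {x : ℝ | α ≤ stdNormalCDF x}

/-! ### Kernels and design matrices built from basis functions -/

section Design

variable {𝒳 : Type*} {n H : ℕ}

/-- The kernel `K_q(x, x') = ∑_{j ≤ q} e_j(x) e_j(x')` (the basis functions are indexed from `0`). -/
def kernel (e : ℕ → 𝒳 → ℝ) (q : ℕ) (x x' : 𝒳) : ℝ := ∑ j : Fin q, e j x * e j x'

/-- The sample kernel matrix. -/
def kernelMatrix (K : 𝒳 → 𝒳 → ℝ) (x : Fin n → 𝒳) : Matrix (Fin n) (Fin n) ℝ :=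
  Matrix.of fun i j => K (x i) (x j)

/-- `M = Γ diag(c) Γᵀ` with `Γ` orthogonal and `c` in descending order. -/
structure IsEigenDecomposition (M Γ : Matrix (Fin n) (Fin n) ℝ) (c : Fin n → ℝ) : Prop where
  orthogonal : Γ ∈ Matrix.orthogonalGroup (Fin n) ℝ
  antitone : Antitone c
  eq : M = Γ * Matrix.diagonal c * Γᵀ

/-- Design matrix of the null model: common coefficients for all groups. -/
def nullDesign (e : ℕ → 𝒳 → ℝ) (q : ℕ) (x : Fin n → 𝒳) : Matrix (Fin n) (Fin q) ℝ :=
  Matrix.of fun i j => e j (x i)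

/-- Design matrix of the full model: separate coefficients for each group. -/
def fullDesign (e : ℕ → 𝒳 → ℝ) (q : ℕ) (x : Fin n → 𝒳) (z : Fin n → Fin H) :
    Matrix (Fin n) (Fin H × Fin q) ℝ :=
  Matrix.of fun i hj => if z i = hj.1 then e hj.2 (x i) else 0

/-- The matrix of the orthogonal projection of `ℝⁿ` onto the column space of `A`. -/
def projMatrix {κ : Type*} [Fintype κ] [DecidableEq κ] (A : Matrix (Fin n) κ ℝ) :
    Matrix (Fin n) (Fin n) ℝ :=
  (Matrix.toEuclideanCLM (n := Fin n) (𝕜 := ℝ)).symm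
    (LinearMap.range (Matrix.toEuclideanLin A)).starProjection

/-- The projection matrix `P₀` of the null model. -/
def P0 (e : ℕ → 𝒳 → ℝ) (q : ℕ) (x : Fin n → 𝒳) : Matrix (Fin n) (Fin n) ℝ :=
  projMatrix (nullDesign e q x)

/-- The projection matrix `P₁` of the full model. -/
def P1 (e : ℕ → 𝒳 → ℝ) (q : ℕ) (x : Fin n → 𝒳) (z : Fin n → Fin H) :
    Matrix (Fin n) (Fin n) ℝ :=
  projMatrix (fullDesign e q x z)

/-- The rank `p₀` of `P₀`. -/
def p0 (e : ℕ → 𝒳 → ℝ) (q : ℕ) (x : Fin n → 𝒳) : ℕ := (P0 e q x).rank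

/-- The rank `p₁` of `P₁`. -/
def p1 (e : ℕ → 𝒳 → ℝ) (q : ℕ) (x : Fin n → 𝒳) (z : Fin n → Fin H) : ℕ := (P1 e q x z).rank

/-- The F statistic for equality of the group coefficients. -/
def fStat (e : ℕ → 𝒳 → ℝ) (q : ℕ) (x : Fin n → 𝒳) (y : Fin n → ℝ) (z : Fin n → Fin H) : ℝ :=
  ((y ⬝ᵥ (P1 e q x z - P0 e q x) *ᵥ y) / ((p1 e q x z : ℝ) - p0 e q x)) /
    ((y ⬝ᵥ (1 - P1 e q x z) *ᵥ y) / ((n : ℝ) - p1 e q x z))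

/-- The vector `(f_{z_1}(x_1), …, f_{z_n}(x_n))`. -/
def meanVec (f : Fin H → 𝒳 → ℝ) (x : Fin n → 𝒳) (z : Fin n → Fin H) : Fin n → ℝ :=
  fun i => f (z i) (x i)

/-- The standardized signal `fᵀ (I - P₀) f / (σ² √(p₁ - p₀))`. -/
def signal (e : ℕ → 𝒳 → ℝ) (q : ℕ) (f : Fin H → 𝒳 → ℝ) (σ : ℝ≥0)
    (x : Fin n → 𝒳) (z : Fin n → Fin H) : ℝ :=
  (meanVec f x z ⬝ᵥ (1 - P0 e q x) *ᵥ meanVec f x z) /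
    ((σ : ℝ) ^ 2 * √((p1 e q x z : ℝ) - p0 e q x))

/-- `r(f; q)`, the squared `L²(μ)` error of the best approximation of `f` by the first `q` basis
functions (for square-integrable functions the infimum is a minimum). -/
def approxError [MeasurableSpace 𝒳] (μ : Measure 𝒳) (e : ℕ → 𝒳 → ℝ) (f : 𝒳 → ℝ) (q : ℕ) : ℝ :=
  ⨅ b : Fin q → ℝ, ∫ x, (f x - ∑ j : Fin q, b j * e j x) ^ 2 ∂μ

end Design

/-! ### The continuous partial permutation test -/

open Classical in
/-- The uniform distribution on the sphere `{v ∈ ℝ^ι : ∑ v_i² = R²}`: the normalized surface measure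
of the unit sphere, scaled by `R`. For empty `ι` it is the unit mass at the only point of `ℝ^ι`. -/
def uniformSphere (ι : Type*) [Fintype ι] (R : ℝ) : Measure (EuclideanSpace ℝ ι) :=
  if IsEmpty ι then Measure.dirac 0
  else
    ((volume : Measure (EuclideanSpace ℝ ι)).toSphere Set.univ)⁻¹ •
      Measure.map
        (fun u : Metric.sphere (0 : EuclideanSpace ℝ ι) 1 => R • (u : EuclideanSpace ℝ ι))
        (volume : Measure (EuclideanSpace ℝ ι)).toSphere

section PermutationTest

variable {n : ℕ}

/-- The last `b` of the `n` coordinates. -/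
abbrev LastCoords (n b : ℕ) : Type := {i : Fin n // n ≤ (i : ℕ) + b}

/-- Replace the last `b` coordinates of `w` by `v`. -/
def replaceLast (b : ℕ) (w : Fin n → ℝ) (v : EuclideanSpace ℝ (LastCoords n b)) : Fin n → ℝ :=
  fun i => if h : n ≤ (i : ℕ) + b then v ⟨i, h⟩ else w i

/-- The law of `Yᵖ = Γ Wᵖ` given the data, where `W = Γᵀ Y` and `Wᵖ` is uniform on the set of all
`W*` with the first `n - b` coordinates of `W` and the same sum of squares of the last `b`. -/
def permLaw (Γ : Matrix (Fin n) (Fin n) ℝ) (b : ℕ) (y : Fin n → ℝ) : Measure (Fin n → ℝ) :=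
  (uniformSphere (LastCoords n b) (√(∑ i : LastCoords n b, (Γᵀ *ᵥ y) i ^ 2))).map
    (fun v => Γ *ᵥ replaceLast b (Γᵀ *ᵥ y) v)

/-- The `p`-value of the continuous partial permutation test with eigenvector matrix `Γ`,
permutation size `b` and test statistic `T` (a function of the response, the covariates and the
group indicators being held fixed). -/
def permPValue (Γ : Matrix (Fin n) (Fin n) ℝ) (b : ℕ) (T : (Fin n → ℝ) → ℝ) (y : Fin n → ℝ) : ℝ :=
  (permLaw Γ b y).real {y' | T y ≤ T y'}

/-- The `p`-value of the continuous partial permutation test with permutation size `n - p₀` and the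
F statistic. -/
def fPValue {𝒳 : Type*} {H : ℕ} (e : ℕ → 𝒳 → ℝ) (q : ℕ) (Γ : Matrix (Fin n) (Fin n) ℝ)
    (x : Fin n → 𝒳) (y : Fin n → ℝ) (z : Fin n → Fin H) : ℝ :=
  permPValue Γ (n - p0 e q x) (fun y' => fStat e q x y' z) y

end PermutationTest

/-! ### The alternative model -/

/-- `(X_i, Y_i, Z_i)`, `i ≤ n`, are samples from `Y_i = f_{Z_i}(X_i) + ε_i`, where, given all the
covariates and group indicators, the noises are i.i.d. `N(0, σ²)`, and every `X_i` has law `μ`. The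
joint law of the `X_i` and `Z_i` is otherwise arbitrary. -/
structure IsSampleH1 {Ω 𝒳 : Type*} [MeasurableSpace Ω] [MeasurableSpace 𝒳] {n H : ℕ}
    (P : Measure Ω) (μ : Measure 𝒳) (f : Fin H → 𝒳 → ℝ) (σ : ℝ≥0)
    (X : Ω → Fin n → 𝒳) (Y : Ω → Fin n → ℝ) (Z : Ω → Fin n → Fin H) (ε : Ω → Fin n → ℝ) :
    Prop where
  measurable_X : Measurable X
  measurable_Z : Measurable Z
  measurable_noise : Measurable ε
  law_X : ∀ i, P.map (fun ω => X ω i) = μ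
  model : ∀ ω i, Y ω i = f (Z ω i) (X ω i) + ε ω i
  law_noise : ∀ i, P.map (fun ω => ε ω i) = gaussianReal 0 (σ ^ 2)
  iIndep_noise : iIndepFun (fun i ω => ε ω i) P
  indep_noise : IndepFun (fun ω => (X ω, Z ω)) ε P

end PartialPerm

end

noncomputable section

namespace PartialPerm

/-! ### Moments of the standard normal distribution -/

/-! Fix the design. The F statistic is a ratio of normalized squared lengths of projections of `Y`:
onto `diffSpace`, the part of the full column space orthogonal to the null one, of dimension `a = p₁
- p₀`, and onto the orthogonal complement of the full column space, of dimension `b = n - p₁`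
(`fStat_eq_fRatio`). It is unchanged by nonzero scaling and by adding a vector of the null space.

The first `p₀` eigenvectors of the kernel matrix lie in the null space
(`IsEigenDecomposition.col_mem`), so the frozen coordinates do not affect F. The resampled ones are
uniform on a sphere, which is the law of a rescaled Gaussian vector
(`uniformSphere_eq_map_stdGaussian`), and F ignores the scaling. Hence, apart from a degenerate
case, the p-value is the tail of F at pure Gaussian noise (`fPValue_eq_or`), and the test is the
classical F test.

For Gaussian data with mean `u` and unit variance, the numerator of F is a squared signal, plus a
cross term, plus a chi-squared variable with `a` degrees of freedom. After division by `√(2a)` the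
last is asymptotically normal and the signal adds the shift `θ/√2`. The cross term is negligible by
Chebyshev's inequality, and so is the fluctuation of the denominator since `a/b → 0`
(`fRatio_tail`). With `u = 0` this locates the critical value near `-z_α` (`rejection_iff_approx`);
with the actual mean it gives the power `Φ(z_α + θ/√2)`.

These estimates are uniform over designs satisfying explicit inequalities, so they can be integrated
over a random design independent of the noise (`rejection_probability`). The hypotheses make such
designs likely; Markov's inequality with `r(f; q)` controls the part of the mean outside the full
model (`tendsto_large_residual`). -/

lemma memLp_sq_gaussianReal : MemLp (fun x : ℝ => x ^ 2) 2 (gaussianReal 0 1) := by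
  have h := memLp_id_gaussianReal' (μ := 0) (v := 1) 4 (by simp)
  have := h.norm_rpow_div (2 : ℝ≥0∞)
  have e : (4 : ℝ≥0∞) / 2 = 2 := by
    rw [show (4 : ℝ≥0∞) = 2 * 2 by norm_num, mul_div_assoc, ENNReal.div_self] <;> simp
  rw [e] at this
  refine this.congr_norm (by fun_prop) (ae_of_all _ fun x => ?_)
  simp

lemma integral_sq_gaussianReal : ∫ x, x ^ 2 ∂gaussianReal 0 1 = 1 := by
  have h := variance_eq_integral (μ := gaussianReal 0 1) (X := fun x => x) (by fun_prop)
  simp only [variance_fun_id_gaussianReal, integral_id_gaussianReal, sub_zero] at h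
  simpa using h.symm

lemma integral_pow_four_gaussianReal : ∫ x, x ^ 4 ∂gaussianReal 0 1 = 3 := by
  have h : ∫ x, x ^ 4 ∂gaussianReal 0 1
      = iteratedDeriv 4 (mgf (fun x ↦ x) (gaussianReal 0 1)) 0 := by
    rw [iteratedDeriv_mgf_zero] <;> simp
  -- Differentiating `p(t) exp(t²/2)` replaces `p` by `p' + t p`; four such steps from `p = 1` leave
  -- the constant term 3.
  have d (p p' : ℝ → ℝ) (hp : ∀ t, HasDerivAt p (p' t) t) :
      deriv (fun t => p t * Real.exp (t ^ 2 / 2))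
        = fun t => (p' t + t * p t) * Real.exp (t ^ 2 / 2) := by
    ext t
    have h2 : HasDerivAt (fun t : ℝ => t ^ 2 / 2) t t := by
      simpa using (hasDerivAt_pow 2 t).div_const 2
    refine ((hp t).mul h2.exp).deriv.trans ?_
    ring
  have e0 : mgf (fun x ↦ x) (gaussianReal 0 1) = fun t => 1 * Real.exp (t ^ 2 / 2) := by
    rw [mgf_fun_id_gaussianReal]; ext t; simp
  rw [h, e0, iteratedDeriv_succ, iteratedDeriv_succ, iteratedDeriv_succ, iteratedDeriv_one,
    d (fun _ => 1) (fun _ => 0) (fun t => hasDerivAt_const _ _),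
    d (fun t => 0 + t * 1) (fun _ => 1) (fun t => by simpa using! hasDerivAt_id t),
    d (fun t => 1 + t * (0 + t * 1)) (fun t => 2 * t) (fun t => by
      have h2 := (hasDerivAt_pow 2 t).const_add 1
      refine (h2.congr_deriv (by simp)).congr_of_eventuallyEq (.of_forall fun x => ?_)
      simp only; ring),
    d (fun t => 2 * t + t * (1 + t * (0 + t * 1))) (fun t => 3 + 3 * t ^ 2) (fun t => by
      have h3 := ((hasDerivAt_pow 3 t).add ((hasDerivAt_id t).const_mul 3))
      refine (h3.congr_deriv (by simp; ring)).congr_of_eventuallyEq (.of_forall fun x => ?_)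
      simp; ring)]
  norm_num

lemma variance_sq_gaussianReal : Var[fun x : ℝ => x ^ 2; gaussianReal 0 1] = 2 := by
  rw [variance_eq_sub memLp_sq_gaussianReal]
  simp only [Pi.pow_apply, ← pow_mul]
  norm_num [integral_pow_four_gaussianReal, integral_sq_gaussianReal]

/-! ### The chi-squared distribution -/

/-- The chi-squared distribution with `a` degrees of freedom. -/
def chiSq (a : ℕ) : Measure ℝ :=
  (Measure.pi fun _ : Fin a => gaussianReal 0 1).map fun x => ∑ i, x i ^ 2

lemma measurable_sum_sq (a : ℕ) : Measurable fun x : Fin a → ℝ => ∑ i, x i ^ 2 :=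
  Finset.measurable_sum _ fun i _ => (measurable_pi_apply i).pow_const 2

instance (a : ℕ) : IsProbabilityMeasure (chiSq a) :=
  Measure.isProbabilityMeasure_map (measurable_sum_sq a).aemeasurable

lemma memLp_sq_pi (a : ℕ) (i : Fin a) : MemLp (fun x : Fin a → ℝ => x i ^ 2) 2
    (Measure.pi fun _ : Fin a => gaussianReal 0 1) :=
  memLp_sq_gaussianReal.comp_measurePreserving
    (measurePreserving_eval (fun _ : Fin a => gaussianReal 0 1) i)

lemma memLp_id_chiSq (a : ℕ) : MemLp (fun x => x) 2 (chiSq a) := by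
  refine (memLp_map_measure_iff (by fun_prop) (measurable_sum_sq a).aemeasurable).2 ?_
  exact memLp_finsetSum _ fun i _ => memLp_sq_pi a i

lemma integral_id_chiSq (a : ℕ) : ∫ x, x ∂chiSq a = a := by
  rw [chiSq, integral_map (measurable_sum_sq a).aemeasurable (by fun_prop), integral_finsetSum]
  · have (i : Fin a) : ∫ x : Fin a → ℝ, x i ^ 2 ∂(Measure.pi fun _ : Fin a => gaussianReal 0 1)
        = 1 := by
      have hi := measurePreserving_eval (fun _ : Fin a => gaussianReal 0 1) i
      have := integral_map hi.aemeasurable (f := fun x : ℝ => x ^ 2) (by fun_prop)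
      rw [hi.map_eq, integral_sq_gaussianReal] at this
      exact this.symm
    simp [this]
  · exact fun i _ => (memLp_sq_pi a i).integrable (by norm_num)

lemma variance_id_chiSq (a : ℕ) : Var[fun x => x; chiSq a] = 2 * a := by
  have h := variance_sum_pi (μ := fun _ : Fin a => gaussianReal 0 1) (X := fun _ x => x ^ 2)
    (fun i => memLp_sq_gaussianReal)
  simp only [variance_sq_gaussianReal] at h
  rw [chiSq, variance_map (by fun_prop) (measurable_sum_sq a).aemeasurable]
  simp only [Finset.sum_const, Finset.card_univ, Fintype.card_fin, nsmul_eq_mul] at h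
  rw [mul_comm, ← h]
  congr 1
  ext x; simp

lemma chiSq_deviation_le (a : ℕ) {c : ℝ} (hc : 0 < c) :
    (chiSq a).real {x | c ≤ |x - a|} ≤ 2 * a / c ^ 2 := by
  have h := meas_ge_le_variance_div_sq (memLp_id_chiSq a) hc
  rw [variance_id_chiSq, integral_id_chiSq] at h
  exact ENNReal.toReal_le_of_le_ofReal (by positivity) h

lemma stdNormalCDF_neg (t : ℝ) : stdNormalCDF (-t) = (gaussianReal 0 1).real (Set.Ici t) := by
  rw [stdNormalCDF, cdf_eq_real]
  have : gaussianReal 0 1 = (gaussianReal 0 1).map (fun x ↦ -x) := by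
    rw [gaussianReal_map_neg, neg_zero]
  conv_rhs => rw [this]
  rw [map_measureReal_apply (by fun_prop) measurableSet_Ici]
  congr 1
  ext x; simp

/-- The central limit theorem for chi-squared distributions. -/
lemma tendsto_chiSq_tail (t : ℝ) :
    Tendsto (fun a : ℕ => (chiSq a).real {x | t ≤ (x - a) / √(2 * a)}) atTop
      (𝓝 (stdNormalCDF (-t))) := by
  obtain ⟨Ω, _, P, X, hXm, hX, hind, _⟩ := exists_iid.{0, 0} ℕ (gaussianReal 0 1)
  have integ : Integrable (fun x : ℝ => x ^ 2) (gaussianReal 0 1) :=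
    memLp_sq_gaussianReal.integrable (by norm_num)
  have hlaw (a : ℕ) : P.map (fun ω => ∑ k ∈ Finset.range a, X k ω ^ 2) = chiSq a := by
    have h1 := (iIndepFun_iff_map_fun_eq_pi_map (fun i : Fin a => (hXm i).aemeasurable)).1
      (hind.precomp (g := fun i : Fin a => (i : ℕ)) Fin.val_injective)
    simp only [(hX _).map_eq] at h1
    rw [chiSq, ← h1, Measure.map_map (by fun_prop) (by fun_prop)]
    congr 1
    ext ω
    simp [Finset.sum_range]
  -- The squares have mean 1 and variance 2, so `(X² - 1)/√2` is centred with unit variance.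
  have key := tendstoInDistribution_inv_sqrt_mul_sum (P := P) (P' := gaussianReal 0 1)
    (Y := id) (X := fun k ω => (X k ω ^ 2 - 1) / √2) HasLaw.id ?_ ?_ ?_ ?_
  · have := ProbabilityMeasure.tendsto_measure_of_null_frontier_of_tendsto' key.tendsto
      (E := Set.Ici t) (by simp [nullSingletonClass_gaussianReal])
    have := (ENNReal.tendsto_toReal (by simp)).comp this
    rw [stdNormalCDF_neg]
    simp only [Measure.map_id, ProbabilityMeasure.coe_mk] at this
    refine this.congr fun a => ?_
    simp only [Function.comp_apply, ← hlaw]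
    rw [Measure.map_apply (by fun_prop) measurableSet_Ici, measureReal_def,
      Measure.map_apply (by fun_prop)
        (measurableSet_le measurable_const (by fun_prop))]
    congr 2
    ext ω
    simp only [Set.mem_preimage, Set.mem_Ici, Set.mem_ofPred_eq]
    rw [← Finset.sum_div, Finset.sum_sub_distrib, Real.sqrt_mul (by norm_num)]
    simp only [Finset.sum_const, Finset.card_range, nsmul_eq_mul, mul_one]
    rw [inv_mul_eq_div, div_div]
  · have := (hX 0).integral_comp (f := fun x => (x ^ 2 - 1) / √2) (by fun_prop)
    refine this.trans ?_
    rw [integral_div, integral_sub integ (by simp), integral_sq_gaussianReal]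
    simp
  · have := (hX 0).integral_comp (f := fun x => ((x ^ 2 - 1) / √2) ^ 2) (by fun_prop)
    refine this.trans ?_
    have hv := variance_eq_integral (μ := gaussianReal 0 1) (X := fun x : ℝ => x ^ 2) (by fun_prop)
    rw [variance_sq_gaussianReal, integral_sq_gaussianReal] at hv
    simp only [div_pow, integral_div, ← hv]
    norm_num
  · exact hind.comp (fun _ x => (x ^ 2 - 1) / √2) (by fun_prop)
  · intro i
    exact (IdentDistrib.mk (hXm i).aemeasurable (hXm 0).aemeasurable
      (by rw [(hX i).map_eq, (hX 0).map_eq])).comp (u := fun x => (x ^ 2 - 1) / √2) (by fun_prop)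

/-! ### The standard normal distribution function -/

lemma stdNormalCDF_eq (x : ℝ) : stdNormalCDF x = (gaussianReal 0 1).real (Set.Iic x) := by
  rw [stdNormalCDF, cdf_eq_real]

lemma monotone_stdNormalCDF : Monotone stdNormalCDF := monotone_cdf _

lemma continuous_stdNormalCDF : Continuous stdNormalCDF := by
  have hna := nullSingletonClass_gaussianReal (μ := 0) (v := 1) one_ne_zero
  refine continuous_iff_continuousAt.2 fun x => ?_
  refine (monotone_stdNormalCDF.continuousAt_iff_leftLim_eq_rightLim).2 ?_
  have hr : Function.rightLim stdNormalCDF x = stdNormalCDF x := (cdf (gaussianReal 0 1)).rightLim_eq x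
  have h1 : (cdf (gaussianReal 0 1)).measure {x} = 0 := by
    rw [measure_cdf]; simp
  rw [StieltjesFunction.measure_singleton, ENNReal.ofReal_eq_zero] at h1
  have h2 := monotone_stdNormalCDF.leftLim_le (le_refl x)
  have h3 : stdNormalCDF x - Function.leftLim stdNormalCDF x ≤ 0 := h1
  rw [hr]; linarith

lemma strictMono_stdNormalCDF : StrictMono stdNormalCDF := by
  intro x y hxy
  have h0 : gaussianReal 0 1 (Set.Ioo x y) ≠ 0 := fun h => by
    have := gaussianReal_absolutelyContinuous' 0 (v := 1) one_ne_zero h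
    simp at this
    linarith
  have h1 : (gaussianReal 0 1).real (Set.Iic x) + (gaussianReal 0 1).real (Set.Ioo x y)
      ≤ (gaussianReal 0 1).real (Set.Iic y) := by
    rw [← measureReal_union _ measurableSet_Ioo]
    · exact measureReal_mono (by
        rintro z (hz | hz)
        · exact le_trans hz hxy.le
        · exact hz.2.le)
    · exact Set.disjoint_left.2 fun z hz hz' => absurd hz'.1 (not_lt.2 hz)
  rw [stdNormalCDF_eq, stdNormalCDF_eq]
  have : 0 < (gaussianReal 0 1).real (Set.Ioo x y) :=
    ENNReal.toReal_pos h0 (measure_ne_top _ _)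
  linarith

lemma stdNormalCDF_lt_of_lt_quantile {α x : ℝ} (hα : 0 < α) (hx : x < stdNormalQuantile α) :
    stdNormalCDF x < α := by
  have hb : BddBelow {x : ℝ | α ≤ stdNormalCDF x} := by
    obtain ⟨m, hm⟩ := ((tendsto_cdf_atBot (gaussianReal 0 1)).eventually_lt_const hα).exists
    refine ⟨m, fun y hy => ?_⟩
    by_contra! hlt
    exact absurd (hy.trans (monotone_stdNormalCDF hlt.le)) (not_le.2 hm)
  by_contra! h
  exact absurd (csInf_le hb h) (not_le.2 hx)

/-- The infimum supplies a point below `x` where `α` is already reached; strict monotonicity makes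
the inequality strict. -/
lemma lt_stdNormalCDF_of_quantile_lt {α x : ℝ} (hα : α < 1) (hx : stdNormalQuantile α < x) :
    α < stdNormalCDF x := by
  have hne : {x : ℝ | α ≤ stdNormalCDF x}.Nonempty := by
    obtain ⟨m, hm⟩ := ((tendsto_cdf_atTop (gaussianReal 0 1)).eventually_const_lt hα).exists
    exact ⟨m, hm.le⟩
  obtain ⟨y, hy, hyx⟩ := exists_lt_of_csInf_lt hne hx
  exact lt_of_le_of_lt hy (strictMono_stdNormalCDF hyx)

/-! ### Projections of a standard Gaussian vector -/

section Projection

variable {E : Type*} [NormedAddCommGroup E] [InnerProductSpace ℝ E] [FiniteDimensional ℝ E]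
  [MeasurableSpace E] [BorelSpace E]

/-- The adjoint `J` preserves norms and the characteristic function of a standard Gaussian depends
only on the norm. This covers orthogonal projections as well as the selection of coordinates in a
rotated basis. -/
lemma stdGaussian_map_of_inner {F : Type*} [NormedAddCommGroup F] [InnerProductSpace ℝ F]
    [FiniteDimensional ℝ F] [MeasurableSpace F] [BorelSpace F] {A : E → F} (hA : Measurable A)
    {J : F → E} (hAJ : ∀ x t, inner ℝ (A x) t = inner ℝ x (J t)) (hJ : ∀ t, ‖J t‖ = ‖t‖) :
    (stdGaussian E).map A = stdGaussian F := by
  have : IsProbabilityMeasure ((stdGaussian E).map A) :=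
    Measure.isProbabilityMeasure_map hA.aemeasurable
  refine Measure.ext_of_charFun ?_
  ext t
  rw [charFun_stdGaussian, charFun_apply, integral_map (by fun_prop) (by fun_prop), ← hJ,
    ← charFun_stdGaussian, charFun_apply]
  simp_rw [hAJ]

lemma stdGaussian_map_orthogonalProjection (U : Submodule ℝ E) :
    (stdGaussian E).map U.orthogonalProjectionOnto = stdGaussian U :=
  stdGaussian_map_of_inner (by fun_prop) (J := Subtype.val)
    (fun x t => Submodule.inner_orthogonalProjectionOnto_eq_of_mem_right t x) (fun _ => rfl)

lemma stdGaussian_map_norm_sq :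
    (stdGaussian E).map (fun v => ‖v‖ ^ 2) = chiSq (Module.finrank ℝ E) := by
  have b := stdOrthonormalBasis ℝ E
  rw [stdGaussian_eq_map_pi_orthonormalBasis b, Measure.map_map (by fun_prop) (by fun_prop), chiSq]
  congr 1
  ext x
  simp only [Function.comp_apply]
  rw [← real_inner_self_eq_norm_sq, b.orthonormal.inner_sum]
  simp [sq]

lemma stdGaussian_map_norm_sq_starProjection (U : Submodule ℝ E) :
    (stdGaussian E).map (fun v => ‖U.starProjection v‖ ^ 2) = chiSq (Module.finrank ℝ U) := by
  rw [← stdGaussian_map_norm_sq, ← stdGaussian_map_orthogonalProjection U,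
    Measure.map_map (by fun_prop) (by fun_prop)]
  rfl

lemma stdGaussian_starProjection_real (U : Submodule ℝ E) {s : Set ℝ} (hs : MeasurableSet s) :
    (stdGaussian E).real {v | ‖U.starProjection v‖ ^ 2 ∈ s}
      = (chiSq (Module.finrank ℝ U)).real s := by
  rw [← stdGaussian_map_norm_sq_starProjection, map_measureReal_apply (by fun_prop) hs]
  rfl

lemma stdGaussian_inner_le (u : E) {c : ℝ} (hc : 0 < c) :
    (stdGaussian E).real {v | c ≤ |inner ℝ u v|} ≤ ‖u‖ ^ 2 / c ^ 2 := by
  have h2 : MemLp (innerSL ℝ u) 2 (stdGaussian E) := IsGaussian.memLp_dual _ _ _ (by simp)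
  have h := meas_ge_le_variance_div_sq h2 hc
  rw [variance_dual_stdGaussian, integral_strongDual_stdGaussian] at h
  simp only [innerSL_apply_norm, innerSL_apply_apply, sub_zero] at h
  exact ENNReal.toReal_le_of_le_ofReal (by positivity) h

/-- The cross term `2⟪u, v⟫` is small compared with `‖u‖² + m` when `m` is large. -/
lemma stdGaussian_cross_le (u : E) {κ m : ℝ} (hκ : 0 < κ) (hm : 0 < m) :
    (stdGaussian E).real {v | κ * (‖u‖ ^ 2 + m) ≤ |2 * inner ℝ u v|} ≤ 1 / (κ ^ 2 * m) := by
  have hc : 0 < κ * (‖u‖ ^ 2 + m) / 2 := by positivity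
  have h := stdGaussian_inner_le u hc
  have hs : {v : E | κ * (‖u‖ ^ 2 + m) ≤ |2 * inner ℝ u v|}
      = {v | κ * (‖u‖ ^ 2 + m) / 2 ≤ |inner ℝ u v|} := by
    ext v
    simp only [Set.mem_ofPred_eq, abs_mul, abs_two]
    constructor <;> intro h <;> linarith
  rw [hs]
  refine h.trans ?_
  rw [div_le_div_iff₀ (by positivity) (by positivity)]
  -- Chebyshev's bound reduces to `4‖u‖²m ≤ (‖u‖² + m)²`, so the estimate is uniform in `u`.
  have : 0 ≤ κ ^ 2 * (‖u‖ ^ 2 - m) ^ 2 := by positivity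
  nlinarith

end Projection

/-! ### The F ratio of a Gaussian vector -/

section FRatio

/-- The factor `√a` is the scale at which an error of the denominator enters the standardized ratio.
The noise fluctuation contributes `κ`; signal and cross term are at most `4√a`, and `√a · 4√a = 4a ≤
4κb` contributes the other `4κ`. -/
lemma denominator_deviation {a b κ η sw Xw Sw : ℝ} (ha : 1 ≤ a) (hb : 0 < b) (hκ : 0 < κ)
    (hκ1 : κ ≤ 1 / 10) (hη : 0 < η) (hηκ : η ≤ κ) (hab : a ≤ η * b) (hsw : 0 ≤ sw)
    (hsw' : sw ≤ η * √a) (hXw : |Xw| < κ * (sw + √(2 * a))) (hSw : |Sw - b| < κ * b / √a) :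
    √a * |(sw + Xw + Sw) / b - 1| ≤ 5 * κ := by
  have hr : 1 ≤ √a := Real.one_le_sqrt.2 ha
  have hrr : √a * √a = a := Real.mul_self_sqrt (by linarith)
  have h2 : √(2 * a) ≤ 2 * √a := by
    rw [Real.sqrt_mul (by norm_num)]
    have : √2 ≤ 2 := by rw [Real.sqrt_le_left (by norm_num)]; norm_num
    nlinarith
  have e : (sw + Xw + Sw) / b - 1 = (sw + Xw + (Sw - b)) / b := by field_simp; ring
  rw [e, abs_div, abs_of_pos hb, ← mul_div_assoc, div_le_iff₀ hb]
  have h3 : |sw + Xw + (Sw - b)| ≤ sw + |Xw| + |Sw - b| := by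
    refine (abs_add_le _ _).trans (add_le_add ((abs_add_le _ _).trans ?_) le_rfl)
    rw [abs_of_nonneg hsw]
  have h4 : √a * |Sw - b| ≤ κ * b := by
    have := mul_le_mul_of_nonneg_left hSw.le (by linarith : 0 ≤ √a)
    rwa [mul_div_cancel₀ _ (by linarith)] at this
  have h5 : √a * (sw + |Xw|) ≤ 4 * κ * b := by
    have h6 : sw + |Xw| ≤ 4 * √a := by nlinarith
    have : √a * (sw + |Xw|) ≤ 4 * a := by nlinarith
    nlinarith
  nlinarith [mul_le_mul_of_nonneg_left h3 (by linarith : 0 ≤ √a)]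

/-- Rewriting of the event that the standardized F ratio exceeds `t`. -/
lemma le_standardized_iff {a b num den t : ℝ} (ha : 0 < a) (hD : 0 < den / b) :
    t ≤ √(a / 2) * (num / a / (den / b) - 1) ↔
      t * (den / b) + √(a / 2) * (den / b - 1) ≤ (num - a) / √(2 * a) := by
  set D := den / b
  have e1 : √(2 * a) = 2 * √(a / 2) := by
    rw [show 2 * a = 2 ^ 2 * (a / 2) by ring, Real.sqrt_mul (by norm_num),
      Real.sqrt_sq (by norm_num)]
  have hr : 0 < √(a / 2) := Real.sqrt_pos.2 (by linarith)
  have hrr : √(a / 2) * √(a / 2) = a / 2 := Real.mul_self_sqrt (by linarith)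
  have e2 : (num - a) / √(2 * a) = √(a / 2) * (num / a - 1) := by
    rw [e1, div_eq_iff (by positivity)]
    have : √(a / 2) * (num / a - 1) * (2 * √(a / 2))
      = 2 * (√(a / 2) * √(a / 2)) * (num / a - 1) := by ring
    rw [this, hrr]
    field_simp
  rw [e2]
  have e3 : √(a / 2) * (num / a / D - 1) = √(a / 2) * (num / a - D) / D := by
    field_simp
  rw [e3, le_div_iff₀ hD]
  constructor <;> intro h <;> nlinarith

/-- Here `s`, `X`, `S` are the signal, cross and noise parts of the numerator. Of the error `κ(6 +
5|t|)`, the cross term gives `κ` (its remaining share is the factor `1 ± κ` on the signal), the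
centred denominator `5κ`, and the product of `t` with the denominator `5κ|t|`. -/
lemma standardized_bounds {a b κ s X S den t : ℝ} (ha : 1 ≤ a) (hκ : 0 < κ)
    (hκ1 : κ ≤ 1 / 10) (hX : |X| < κ * (s + √(2 * a))) (hD : √a * |den / b - 1| ≤ 5 * κ) :
    (t ≤ √(a / 2) * ((s + X + S) / a / (den / b) - 1) →
      t - (1 + κ) * (s / √(2 * a)) - κ * (6 + 5 * |t|) ≤ (S - a) / √(2 * a)) ∧
    (t - (1 - κ) * (s / √(2 * a)) + κ * (6 + 5 * |t|) ≤ (S - a) / √(2 * a) →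
      t ≤ √(a / 2) * ((s + X + S) / a / (den / b) - 1)) := by
  set D := den / b with hDdef
  have hr : 1 ≤ √a := Real.one_le_sqrt.2 ha
  have hD1 : |D - 1| ≤ 5 * κ := by nlinarith [abs_nonneg (D - 1)]
  have hDpos : 0 < D := by linarith [(abs_le.1 hD1).1]
  have hq : 0 < √(2 * a) := Real.sqrt_pos.2 (by linarith)
  have hX' : |X / √(2 * a)| ≤ κ * (s / √(2 * a)) + κ := by
    rw [abs_div, abs_of_pos hq, div_le_iff₀ hq]
    have : (κ * (s / √(2 * a)) + κ) * √(2 * a) = κ * (s + √(2 * a)) := by field_simp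
    linarith
  have hD2 : |√(a / 2) * (D - 1)| ≤ 5 * κ := by
    rw [abs_mul, abs_of_nonneg (Real.sqrt_nonneg _)]
    refine le_trans ?_ hD
    gcongr
    linarith
  have htD : |t * D - t| ≤ 5 * κ * |t| := by
    rw [show t * D - t = t * (D - 1) by ring, abs_mul]
    nlinarith [abs_nonneg t]
  rw [le_standardized_iff (by linarith) hDpos]
  have e : (s + X + S - a) / √(2 * a) = s / √(2 * a) + X / √(2 * a) + (S - a) / √(2 * a) := by
    ring
  rw [e]
  obtain ⟨h1, h2⟩ := abs_le.1 hX'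
  obtain ⟨h3, h4⟩ := abs_le.1 hD2
  obtain ⟨h5, h6⟩ := abs_le.1 htD
  constructor <;> intro h <;> linarith

variable {n : ℕ}

/-- The ratio of the normalized squared lengths of two projections. -/
def fRatio (U W : Submodule ℝ (EuclideanSpace ℝ (Fin n))) (v : EuclideanSpace ℝ (Fin n)) : ℝ :=
  ‖U.starProjection v‖ ^ 2 / Module.finrank ℝ U / (‖W.starProjection v‖ ^ 2 / Module.finrank ℝ W)

lemma norm_sq_starProjection_add (U : Submodule ℝ (EuclideanSpace ℝ (Fin n)))
    (u g : EuclideanSpace ℝ (Fin n)) :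
    ‖U.starProjection (u + g)‖ ^ 2 = ‖U.starProjection u‖ ^ 2
      + 2 * inner ℝ (U.starProjection u) g + ‖U.starProjection g‖ ^ 2 := by
  rw [map_add, norm_add_sq_real]
  congr 3
  rw [← Submodule.inner_starProjection_left_eq_right,
    Submodule.starProjection_eq_self_iff.2 (Submodule.starProjection_apply_mem _ _)]

/-- Outside an event of small probability, the standardized F ratio of `u + g` is controlled by the
standardized numerator of `g`. -/
lemma exists_exceptional_set {κ : ℝ} (hκ : 0 < κ) (hκ1 : κ ≤ 1 / 10) {δ : ℝ} (hδ : 0 < δ) :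
    ∃ A : ℕ, ∃ η : ℝ, 0 < η ∧ η ≤ κ ∧ ∀ (n : ℕ) (U W : Submodule ℝ (EuclideanSpace ℝ (Fin n)))
      (u : EuclideanSpace ℝ (Fin n)), A ≤ Module.finrank ℝ U → 0 < Module.finrank ℝ U →
      (Module.finrank ℝ U : ℝ) ≤ η * Module.finrank ℝ W →
      ‖W.starProjection u‖ ^ 2 ≤ η * √(Module.finrank ℝ U) →
      ∃ B : Set (EuclideanSpace ℝ (Fin n)), (stdGaussian _).real B ≤ δ ∧ ∀ g ∉ B, ∀ t : ℝ,
        (t ≤ √(Module.finrank ℝ U / 2) * (fRatio U W (u + g) - 1) →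
          t - (1 + κ) * (‖U.starProjection u‖ ^ 2 / √(2 * Module.finrank ℝ U)) - κ * (6 + 5 * |t|)
            ≤ (‖U.starProjection g‖ ^ 2 - Module.finrank ℝ U) / √(2 * Module.finrank ℝ U)) ∧
        (t - (1 - κ) * (‖U.starProjection u‖ ^ 2 / √(2 * Module.finrank ℝ U)) + κ * (6 + 5 * |t|)
            ≤ (‖U.starProjection g‖ ^ 2 - Module.finrank ℝ U) / √(2 * Module.finrank ℝ U) →
          t ≤ √(Module.finrank ℝ U / 2) * (fRatio U W (u + g) - 1)) := by
  have hlim : Tendsto (fun a : ℕ => 1 / (κ ^ 2 * √(2 * a))) atTop (𝓝 0) := by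
    refine tendsto_const_nhds.div_atTop (Tendsto.const_mul_atTop (by positivity) ?_)
    exact Real.tendsto_sqrt_atTop.comp
      (Tendsto.const_mul_atTop (by norm_num) tendsto_natCast_atTop_atTop)
  obtain ⟨A, hA⟩ := eventually_atTop.1 (hlim.eventually_le_const (by positivity : (0 : ℝ) < δ / 3))
  -- Chebyshev bounds the denominator fluctuation by `2a/(κ²b)`, which is at most `δ/3` once `a ≤
  -- (δκ²/6) b`. The threshold `A` makes each of the two cross terms cost at most `δ/3`.
  refine ⟨A, min κ (δ * κ ^ 2 / 6), by positivity, min_le_left _ _, ?_⟩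
  intro n U W u hAU hU hUW hWu
  set a := Module.finrank ℝ U
  set b := Module.finrank ℝ W
  set η := min κ (δ * κ ^ 2 / 6)
  have hη : 0 < η := by positivity
  have ha1 : (1 : ℝ) ≤ a := by exact_mod_cast hU
  -- Positivity of `b` is forced by `1 ≤ a ≤ ηb`.
  have hb : (0 : ℝ) < b := by
    by_contra! h
    nlinarith
  have hq : 0 < √(2 * (a : ℝ)) := Real.sqrt_pos.2 (by linarith)
  have hr : 0 < √(a : ℝ) := Real.sqrt_pos.2 (by linarith)
  refine ⟨{g | κ * (‖U.starProjection u‖ ^ 2 + √(2 * a)) ≤ |2 * inner ℝ (U.starProjection u) g|} ∪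
    {g | κ * (‖W.starProjection u‖ ^ 2 + √(2 * a)) ≤ |2 * inner ℝ (W.starProjection u) g|} ∪
    {g | ‖W.starProjection g‖ ^ 2 ∈ {x : ℝ | κ * b / √a ≤ |x - b|}}, ?_, ?_⟩
  · refine (measureReal_union_le _ _).trans ((add_le_add (measureReal_union_le _ _) le_rfl).trans ?_)
    have h1 := stdGaussian_cross_le (U.starProjection u) hκ hq
    have h2 := stdGaussian_cross_le (W.starProjection u) hκ hq
    have h3 := chiSq_deviation_le b (c := κ * b / √a) (by positivity)
    rw [← stdGaussian_starProjection_real W (measurableSet_le (by fun_prop) (by fun_prop))] at h3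
    have h4 : 2 * (b : ℝ) / (κ * b / √a) ^ 2 ≤ δ / 3 := by
      rw [div_pow, Real.sq_sqrt (by linarith), div_div_eq_mul_div, div_le_iff₀ (by positivity)]
      have : (a : ℝ) ≤ δ * κ ^ 2 / 6 * b := hUW.trans (by gcongr; exact min_le_right _ _)
      nlinarith
    have h5 := hA a hAU
    linarith
  · intro g hg t
    simp only [Set.mem_union, Set.mem_ofPred_eq, not_or, not_le] at hg
    obtain ⟨⟨hg1, hg2⟩, hg3⟩ := hg
    rw [fRatio, norm_sq_starProjection_add, norm_sq_starProjection_add]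
    exact standardized_bounds ha1 hκ hκ1 hg1 (denominator_deviation ha1 hb hκ hκ1 hη
      (min_le_left _ _) hUW (by positivity) hWu hg2 hg3)

/-- Both perturbed arguments are continuous in `κ` and equal `θ/√2 - t` at `κ = 0`. -/
lemma exists_kappa (t θ : ℝ) {δ : ℝ} (hδ : 0 < δ) : ∃ κ : ℝ, 0 < κ ∧ κ ≤ 1 / 10 ∧
    stdNormalCDF (-(t - (1 + κ) * ((θ + κ) / √2) - κ * (6 + 5 * |t|)))
      < stdNormalCDF (θ / √2 - t) + δ ∧
    stdNormalCDF (θ / √2 - t) - δ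
      < stdNormalCDF (-(t - (1 - κ) * ((θ - κ) / √2) + κ * (6 + 5 * |t|))) := by
  have c1 : Continuous fun κ : ℝ =>
      stdNormalCDF (-(t - (1 + κ) * ((θ + κ) / √2) - κ * (6 + 5 * |t|))) :=
    continuous_stdNormalCDF.comp (by fun_prop)
  have c2 : Continuous fun κ : ℝ =>
      stdNormalCDF (-(t - (1 - κ) * ((θ - κ) / √2) + κ * (6 + 5 * |t|))) :=
    continuous_stdNormalCDF.comp (by fun_prop)
  have h1 := (c1.tendsto 0).eventually_lt_const (u := stdNormalCDF (θ / √2 - t) + δ)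
    (by simpa using hδ)
  have h2 := (c2.tendsto 0).eventually_const_lt (u := stdNormalCDF (θ / √2 - t) - δ)
    (by simpa using hδ)
  have h3 : ∀ᶠ κ : ℝ in 𝓝[>] 0, κ ≤ 1 / 10 :=
    (eventually_le_nhds (by norm_num)).filter_mono nhdsWithin_le_nhds
  obtain ⟨κ, ⟨⟨h1, h2⟩, h3⟩, h4⟩ := (((h1.and h2).filter_mono nhdsWithin_le_nhds).and h3).and
    (self_mem_nhdsWithin : Set.Ioi (0 : ℝ) ∈ 𝓝[>] 0) |>.exists
  exact ⟨κ, h4, h3, h1, h2⟩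

/-- Uniform asymptotics of the tails of the F ratio of a Gaussian vector with mean `u`. -/
theorem fRatio_tail (t θ : ℝ) {δ : ℝ} (hδ : 0 < δ) :
    ∃ A : ℕ, ∃ η : ℝ, 0 < η ∧ ∀ (n : ℕ) (U W : Submodule ℝ (EuclideanSpace ℝ (Fin n)))
      (u : EuclideanSpace ℝ (Fin n)), A ≤ Module.finrank ℝ U → 0 < Module.finrank ℝ U →
      (Module.finrank ℝ U : ℝ) ≤ η * Module.finrank ℝ W →
      ‖W.starProjection u‖ ^ 2 ≤ η * √(Module.finrank ℝ U) →
      (‖U.starProjection u‖ ^ 2 ≤ (θ + η) * √(Module.finrank ℝ U) →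
        (stdGaussian _).real {g | t ≤ √(Module.finrank ℝ U / 2) * (fRatio U W (u + g) - 1)}
          ≤ stdNormalCDF (θ / √2 - t) + δ) ∧
      ((θ - η) * √(Module.finrank ℝ U) ≤ ‖U.starProjection u‖ ^ 2 →
        stdNormalCDF (θ / √2 - t) - δ ≤
          (stdGaussian _).real
            {g | t ≤ √(Module.finrank ℝ U / 2) * (fRatio U W (u + g) - 1)}) := by
  obtain ⟨κ, hκ, hκ1, hup, hlow⟩ := exists_kappa t θ (half_pos hδ)
  obtain ⟨A₁, η, hη, hηκ, hB⟩ := exists_exceptional_set hκ hκ1 (half_pos hδ)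
  have l1 := (tendsto_chiSq_tail (t - (1 + κ) * ((θ + κ) / √2) - κ * (6 + 5 * |t|)))
    |>.eventually_lt_const hup
  have l2 := (tendsto_chiSq_tail (t - (1 - κ) * ((θ - κ) / √2) + κ * (6 + 5 * |t|)))
    |>.eventually_const_lt hlow
  obtain ⟨A₂, hA₂⟩ := eventually_atTop.1 (l1.and l2)
  refine ⟨max A₁ A₂, η, hη, fun n U W u hAU hU hUW hWu => ?_⟩
  obtain ⟨B, hBδ, hBg⟩ := hB n U W u ((le_max_left _ _).trans hAU) hU hUW hWu
  obtain ⟨k1, k2⟩ := hA₂ _ ((le_max_right _ _).trans hAU)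
  set a := Module.finrank ℝ U
  have hr : 0 < √(a : ℝ) := Real.sqrt_pos.2 (by exact_mod_cast hU)
  -- A signal of size `x√a` becomes the shift `x/√2` after division by the standard deviation
  -- `√(2a)` of the chi-squared variable.
  have hscale (x : ℝ) : x / √2 = x * √a / √(2 * a) := by
    rw [Real.sqrt_mul (by norm_num)]; field_simp
  have hms (c : ℝ) : MeasurableSet {x : ℝ | c ≤ (x - a) / √(2 * a)} :=
    measurableSet_le (by fun_prop) (by fun_prop)
  rw [← stdGaussian_starProjection_real U (hms _)] at k1 k2
  constructor
  · intro hu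
    have hs : ‖U.starProjection u‖ ^ 2 / √(2 * a) ≤ (θ + κ) / √2 := by
      rw [hscale]
      gcongr
      exact hu.trans (by gcongr)
    have hsub : {g | t ≤ √(a / 2) * (fRatio U W (u + g) - 1)} ⊆
        {g | ‖U.starProjection g‖ ^ 2 ∈ {x : ℝ |
          t - (1 + κ) * ((θ + κ) / √2) - κ * (6 + 5 * |t|) ≤ (x - a) / √(2 * a)}} ∪ B := by
      intro g hg
      by_cases hgB : g ∈ B
      · exact Or.inr hgB
      · refine Or.inl (le_trans ?_ ((hBg g hgB t).1 hg))
        gcongr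
    have := (measureReal_mono (μ := stdGaussian (EuclideanSpace ℝ (Fin n))) hsub).trans
      (measureReal_union_le _ _)
    linarith
  · intro hu
    have hs : (θ - κ) / √2 ≤ ‖U.starProjection u‖ ^ 2 / √(2 * a) := by
      rw [hscale]
      gcongr
      exact le_trans (by gcongr) hu
    have hsub : {g | ‖U.starProjection g‖ ^ 2 ∈ {x : ℝ |
          t - (1 - κ) * ((θ - κ) / √2) + κ * (6 + 5 * |t|) ≤ (x - a) / √(2 * a)}} ⊆
        {g | t ≤ √(a / 2) * (fRatio U W (u + g) - 1)} ∪ B := by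
      intro g hg
      by_cases hgB : g ∈ B
      · exact Or.inr hgB
      · refine Or.inl ((hBg g hgB t).2 (le_trans ?_ hg))
        have : 0 ≤ 1 - κ := by linarith
        gcongr
    have := (measureReal_mono (μ := stdGaussian (EuclideanSpace ℝ (Fin n))) hsub).trans
      (measureReal_union_le _ _)
    linarith

end FRatio

/-! ### The uniform distribution on a sphere as the direction of a Gaussian vector -/

section UniformSphere

variable {ι : Type*} [Fintype ι]

lemma pi_gaussianReal_eq_withDensity :
    (Measure.pi fun _ : ι => gaussianReal 0 1) = (volume : Measure (ι → ℝ)).withDensity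
      fun x => ENNReal.ofReal (∏ i, gaussianPDFReal 0 1 (x i)) := by
  refine (Measure.pi_eq fun s hs => ?_)
  have hbox : MeasurableSet (Set.univ.pi s) := .univ_pi hs
  have integ (i : ι) : Integrable ((s i).indicator (gaussianPDFReal 0 1)) :=
    (integrable_gaussianPDFReal 0 1).indicator (hs i)
  have hind (x : ι → ℝ) : (Set.univ.pi s).indicator
      (fun x => ENNReal.ofReal (∏ i, gaussianPDFReal 0 1 (x i))) x
      = ENNReal.ofReal (∏ i, (s i).indicator (gaussianPDFReal 0 1) (x i)) := by
    by_cases hx : x ∈ Set.univ.pi s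
    · rw [Set.indicator_of_mem hx]
      congr 1
      exact Finset.prod_congr rfl fun i _ => by rw [Set.indicator_of_mem (hx i trivial)]
    · rw [Set.indicator_of_notMem hx]
      simp only [Set.mem_pi, Set.mem_univ, true_imp_iff, not_forall] at hx
      obtain ⟨i, hi⟩ := hx
      rw [Finset.prod_eq_zero (Finset.mem_univ i) (Set.indicator_of_notMem hi _),
        ENNReal.ofReal_zero]
  rw [withDensity_apply _ hbox, ← lintegral_indicator hbox]
  simp_rw [hind, volume_pi]
  rw [← ofReal_integral_eq_lintegral_ofReal (Integrable.fintype_prod integ)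
    (ae_of_all _ fun x => Finset.prod_nonneg fun i _ =>
      Set.indicator_nonneg (fun _ _ => gaussianPDFReal_nonneg _ _ _) _),
    integral_fintype_prod_eq_prod, ENNReal.ofReal_prod_of_nonneg]
  · refine Finset.prod_congr rfl fun i _ => ?_
    rw [integral_indicator (hs i), gaussianReal_apply_eq_integral 0 one_ne_zero]
  · exact fun i _ => integral_nonneg fun x =>
      Set.indicator_nonneg (fun _ _ => gaussianPDFReal_nonneg _ _ _) _

/-- Only radial symmetry of the density matters later, so the explicit profile is hidden behind `φ`.
-/
lemma stdGaussian_eq_withDensity :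
    ∃ φ : ℝ → ℝ≥0∞, Measurable φ ∧ stdGaussian (EuclideanSpace ℝ ι)
      = (volume : Measure (EuclideanSpace ℝ ι)).withDensity fun x => φ ‖x‖ := by
  refine ⟨fun r => ENNReal.ofReal ((√(2 * Real.pi))⁻¹ ^ Fintype.card ι * Real.exp (-r ^ 2 / 2)),
    by fun_prop, ?_⟩
  have hmp := EuclideanSpace.volume_preserving_symm_measurableEquiv_toLp ι
  rw [← map_pi_eq_stdGaussian, pi_gaussianReal_eq_withDensity]
  ext s hs
  rw [Measure.map_apply (by fun_prop) hs, withDensity_apply _ (by measurability),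
    withDensity_apply _ hs]
  rw [← hmp.symm.setLIntegral_comp_preimage hs (by fun_prop)]
  refine setLIntegral_congr_fun (by measurability) fun x _ => ?_
  congr 1
  simp only [gaussianPDFReal, NNReal.coe_one, mul_one, sub_zero, Finset.prod_mul_distrib,
    Finset.prod_const, Finset.card_univ, ← Real.exp_sum]
  congr 2
  rw [EuclideanSpace.norm_eq, Real.sq_sqrt (by positivity), ← Finset.sum_div,
    Finset.sum_neg_distrib]
  simp

lemma lintegral_polar {E : Type*} [NormedAddCommGroup E] [NormedSpace ℝ E] [MeasurableSpace E]
    [BorelSpace E] [FiniteDimensional ℝ E] [Nontrivial E] (μ : Measure E) [μ.IsAddHaarMeasure]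
    (F : E → ℝ≥0∞) :
    ∫⁻ x, F x ∂μ = ∫⁻ p, F ((p.2 : ℝ) • (p.1 : E))
      ∂(μ.toSphere.prod (Measure.volumeIoiPow (Module.finrank ℝ E - 1))) := by
  have h := μ.measurePreserving_homeomorphUnitSphereProd
  rw [← h.lintegral_comp_emb (Homeomorph.measurableEmbedding _),
    ← setLIntegral_univ, ← setLIntegral_congr (ae_eq_univ.2 (by simp) : ({0}ᶜ : Set E) =ᵐ[μ] _),
    ← lintegral_subtype_comap (measurableSet_singleton _).compl]
  refine lintegral_congr fun x => ?_
  congr 1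
  exact (congrArg Subtype.val ((homeomorphUnitSphereProd E).symm_apply_apply x)).symm

/-- In polar coordinates a radial density separates from the surface measure, so the direction of a
Gaussian vector is uniform. The origin, where division by the norm returns zero, is null in nonempty
dimension; for empty `ι` both sides are the unit mass at the only point. -/
theorem uniformSphere_eq_map_stdGaussian (R : ℝ) :
    uniformSphere ι R = (stdGaussian (EuclideanSpace ℝ ι)).map fun g => (R / ‖g‖) • g := by
  have hmeas : Measurable fun g : EuclideanSpace ℝ ι => (R / ‖g‖) • g := by fun_prop
  rw [uniformSphere]
  split_ifs with hι
  · ext s hs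
    rw [Measure.map_apply hmeas hs, Measure.dirac_apply' _ hs]
    by_cases h0 : (0 : EuclideanSpace ℝ ι) ∈ s
    · have : (fun g : EuclideanSpace ℝ ι => (R / ‖g‖) • g) ⁻¹' s = Set.univ := by
        ext g; simpa [Subsingleton.elim g 0] using h0
      simp [this, h0]
    · have : (fun g : EuclideanSpace ℝ ι => (R / ‖g‖) • g) ⁻¹' s = ∅ := by
        ext g; simpa [Subsingleton.elim g 0] using h0
      simp [this, h0]
  · rw [not_isEmpty_iff] at hι
    obtain ⟨φ, hφ, hγ⟩ := stdGaussian_eq_withDensity (ι := ι)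
    set E := EuclideanSpace ℝ ι
    set m := (volume : Measure E).toSphere
    set ρ := Measure.volumeIoiPow (Module.finrank ℝ E - 1)
    have hRu : Measurable fun u : Metric.sphere (0 : E) 1 => R • (u : E) := by fun_prop
    have key (s : Set E) (hs : MeasurableSet s) :
        stdGaussian E ((fun g => (R / ‖g‖) • g) ⁻¹' s)
          = m ((fun u => R • (u : E)) ⁻¹' s) * ∫⁻ r : Set.Ioi (0 : ℝ), φ r ∂ρ := by
      rw [hγ, withDensity_apply _ (hmeas hs), ← lintegral_indicator (hmeas hs),
        lintegral_polar]
      have : ∀ p : Metric.sphere (0 : E) 1 × Set.Ioi (0 : ℝ),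
          ((fun g : E => (R / ‖g‖) • g) ⁻¹' s).indicator (fun x => φ ‖x‖) ((p.2 : ℝ) • (p.1 : E))
          = ((fun u : Metric.sphere (0 : E) 1 => R • (u : E)) ⁻¹' s).indicator 1 p.1 * φ p.2 := by
        rintro ⟨u, r, hr⟩
        have hr' : (0 : ℝ) < r := hr
        have hn : ‖r • (u : E)‖ = r := by
          rw [norm_smul, norm_eq_of_mem_sphere u, mul_one, Real.norm_of_nonneg hr'.le]
        have he : (R / r) • r • (u : E) = R • (u : E) := by
          rw [smul_smul, div_mul_cancel₀ _ hr'.ne']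
        by_cases hu : R • (u : E) ∈ s
        · rw [Set.indicator_of_mem, Set.indicator_of_mem]
          · simp [hn]
          · exact hu
          · simpa [hn, he] using hu
        · rw [Set.indicator_of_notMem, Set.indicator_of_notMem]
          · simp
          · exact hu
          · simpa [hn, he] using hu
      rw [lintegral_congr this, lintegral_prod_mul (f := Set.indicator _ 1)
        (g := fun r : Set.Ioi (0 : ℝ) => φ r)
        ((measurable_one.indicator (hRu hs)).aemeasurable)
        (hφ.comp measurable_subtype_coe).aemeasurable, lintegral_indicator_one (hRu hs)]
    -- Taking the whole space identifies the radial integral as the inverse of the total surface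
    -- mass, so it need not be computed.
    have htot := key Set.univ .univ
    simp only [Set.preimage_univ, measure_univ] at htot
    ext s hs
    rw [Measure.map_apply hmeas hs, key s hs, Measure.smul_apply, Measure.map_apply hRu hs,
      smul_eq_mul, mul_comm]
    congr 1
    exact (ENNReal.eq_inv_of_mul_eq_one_left (by rw [mul_comm]; exact htot.symm)).symm

lemma stdGaussian_singleton_zero [Nonempty ι] :
    stdGaussian (EuclideanSpace ℝ ι) {0} = 0 := by
  obtain ⟨φ, -, hγ⟩ := stdGaussian_eq_withDensity (ι := ι)
  rw [hγ]
  exact withDensity_absolutelyContinuous _ _ (measure_singleton _)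

end UniformSphere

/-! ### Projection matrices and the F statistic -/

section LinearAlgebra

variable {n : ℕ}

/-- The column space of a matrix. -/
def colSpace {κ : Type*} [Fintype κ] [DecidableEq κ] (A : Matrix (Fin n) κ ℝ) :
    Submodule ℝ (EuclideanSpace ℝ (Fin n)) :=
  LinearMap.range (Matrix.toEuclideanLin A)

lemma projMatrix_mulVec {κ : Type*} [Fintype κ] [DecidableEq κ] (A : Matrix (Fin n) κ ℝ)
    (y : Fin n → ℝ) :
    projMatrix A *ᵥ y = WithLp.ofLp ((colSpace A).starProjection (WithLp.toLp 2 y)) := by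
  have h := Matrix.ofLp_toEuclideanCLM (𝕜 := ℝ) (projMatrix A) (WithLp.toLp 2 y)
  rw [projMatrix, StarAlgEquiv.apply_symm_apply] at h
  exact h.symm

lemma dotProduct_projMatrix {κ : Type*} [Fintype κ] [DecidableEq κ] (A : Matrix (Fin n) κ ℝ)
    (y : Fin n → ℝ) :
    y ⬝ᵥ projMatrix A *ᵥ y = ‖(colSpace A).starProjection (WithLp.toLp 2 y)‖ ^ 2 := by
  rw [projMatrix_mulVec, ← real_inner_self_eq_norm_sq, Submodule.inner_starProjection_left_eq_right,
    Submodule.starProjection_eq_self_iff.2 (Submodule.starProjection_apply_mem _ _),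
    EuclideanSpace.inner_eq_star_dotProduct, dotProduct_comm]
  simp

lemma rank_projMatrix {κ : Type*} [Fintype κ] [DecidableEq κ] (A : Matrix (Fin n) κ ℝ) :
    (projMatrix A).rank = Module.finrank ℝ (colSpace A) := by
  have h : Matrix.toEuclideanLin (projMatrix A)
      = ((colSpace A).starProjection : EuclideanSpace ℝ (Fin n) →ₗ[ℝ] _) := by
    ext v i
    rw [Matrix.ofLp_toLpLin, Matrix.toLin'_apply, projMatrix_mulVec]
    rfl
  rw [Matrix.rank_eq_finrank_range_toLin _ (EuclideanSpace.basisFun (Fin n) ℝ).toBasis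
    (EuclideanSpace.basisFun (Fin n) ℝ).toBasis, ← Matrix.toEuclideanLin_eq_toLin_orthonormal, h,
    Submodule.range_starProjection]

lemma rank_eq_finrank_colSpace {κ : Type*} [Fintype κ] [DecidableEq κ] (A : Matrix (Fin n) κ ℝ) :
    A.rank = Module.finrank ℝ (colSpace A) := by
  rw [Matrix.rank_eq_finrank_range_toLin _ (EuclideanSpace.basisFun (Fin n) ℝ).toBasis
    (EuclideanSpace.basisFun κ ℝ).toBasis, ← Matrix.toEuclideanLin_eq_toLin_orthonormal]
  rfl

variable {V₀ V₁ : Submodule ℝ (EuclideanSpace ℝ (Fin n))}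

lemma starProjection_inf_orthogonal (h : V₀ ≤ V₁) (y : EuclideanSpace ℝ (Fin n)) :
    (V₁ ⊓ V₀ᗮ).starProjection y = V₁.starProjection y - V₀.starProjection y := by
  refine Submodule.eq_starProjection_of_mem_orthogonal (K := V₁ ⊓ V₀ᗮ)
    (Submodule.mem_inf.2 ⟨?_, ?_⟩) ?_
  · exact sub_mem (Submodule.starProjection_apply_mem _ _)
      (h (Submodule.starProjection_apply_mem _ _))
  · have := sub_mem (V₀.sub_starProjection_mem_orthogonal y)
      (Submodule.orthogonal_le h (V₁.sub_starProjection_mem_orthogonal y))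
    simpa using this
  · have h1 := Submodule.orthogonal_le (inf_le_left : V₁ ⊓ V₀ᗮ ≤ V₁)
      (V₁.sub_starProjection_mem_orthogonal y)
    have h2 : V₀.starProjection y ∈ (V₁ ⊓ V₀ᗮ)ᗮ :=
      Submodule.orthogonal_le inf_le_right
        (V₀.le_orthogonal_orthogonal (Submodule.starProjection_apply_mem _ _))
    have := add_mem h1 h2
    rwa [sub_add] at this

lemma norm_sq_starProjection_inf (h : V₀ ≤ V₁) (y : EuclideanSpace ℝ (Fin n)) :
    ‖(V₁ ⊓ V₀ᗮ).starProjection y‖ ^ 2 = ‖V₁.starProjection y‖ ^ 2 - ‖V₀.starProjection y‖ ^ 2 := by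
  have e : V₁.starProjection y = (V₁ ⊓ V₀ᗮ).starProjection y + V₀.starProjection y := by
    rw [starProjection_inf_orthogonal h]; abel
  have ho : inner ℝ ((V₁ ⊓ V₀ᗮ).starProjection y) (V₀.starProjection y) = 0 :=
    Submodule.inner_left_of_mem_orthogonal (Submodule.starProjection_apply_mem _ _)
      ((V₁ ⊓ V₀ᗮ).starProjection_apply_mem y).2
  rw [e, norm_add_sq_real, ho]
  ring

lemma norm_sq_starProjection_orthogonal (y : EuclideanSpace ℝ (Fin n)) :
    ‖V₁ᗮ.starProjection y‖ ^ 2 = ‖y‖ ^ 2 - ‖V₁.starProjection y‖ ^ 2 := by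
  rw [Submodule.norm_sq_eq_add_norm_sq_starProjection y V₁]; ring

lemma finrank_inf_orthogonal (h : V₀ ≤ V₁) :
    (Module.finrank ℝ (V₁ ⊓ V₀ᗮ : Submodule ℝ (EuclideanSpace ℝ (Fin n))) : ℝ)
      = Module.finrank ℝ V₁ - Module.finrank ℝ V₀ := by
  have := Submodule.finrank_add_inf_finrank_orthogonal h
  rw [inf_comm] at this
  rw [← this]; push_cast; ring

lemma finrank_orthogonal_eq :
    (Module.finrank ℝ (V₁ᗮ : Submodule ℝ (EuclideanSpace ℝ (Fin n))) : ℝ)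
      = n - Module.finrank ℝ V₁ := by
  have := Submodule.finrank_add_finrank_orthogonal V₁
  rw [finrank_euclideanSpace_fin] at this
  rw [eq_sub_iff_add_eq']; exact_mod_cast this

end LinearAlgebra

section Design

variable {𝒳 : Type*} {n H : ℕ} (e : ℕ → 𝒳 → ℝ) (q : ℕ) (x : Fin n → 𝒳) (z : Fin n → Fin H)

/-- The column space of the null design. -/
abbrev nullSpace : Submodule ℝ (EuclideanSpace ℝ (Fin n)) := colSpace (nullDesign e q x)

/-- The column space of the full design. -/
abbrev fullSpace : Submodule ℝ (EuclideanSpace ℝ (Fin n)) := colSpace (fullDesign e q x z)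

/-- The orthogonal complement of the null space in the full space. -/
abbrev diffSpace : Submodule ℝ (EuclideanSpace ℝ (Fin n)) :=
  fullSpace e q x z ⊓ (nullSpace e q x)ᗮ

lemma nullSpace_le_fullSpace : nullSpace e q x ≤ fullSpace e q x z := by
  rintro _ ⟨b, rfl⟩
  -- A null fit is a full fit that repeats the same coefficients in every group.
  refine ⟨WithLp.toLp 2 fun hj => b hj.2, ?_⟩
  ext i
  simp [Matrix.mulVec, dotProduct, fullDesign, nullDesign, Fintype.sum_prod_type]

lemma p0_eq : p0 e q x = Module.finrank ℝ (nullSpace e q x) := rank_projMatrix _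

lemma p1_eq : p1 e q x z = Module.finrank ℝ (fullSpace e q x z) := rank_projMatrix _

lemma finrank_diffSpace :
    (Module.finrank ℝ (diffSpace e q x z) : ℝ) = (p1 e q x z : ℝ) - p0 e q x := by
  rw [finrank_inf_orthogonal (nullSpace_le_fullSpace e q x z), p0_eq, p1_eq]

lemma finrank_residualSpace :
    (Module.finrank ℝ (fullSpace e q x z)ᗮ : ℝ) = (n : ℝ) - p1 e q x z := by
  rw [finrank_orthogonal_eq, p1_eq]

lemma dotProduct_self_eq (y : Fin n → ℝ) : y ⬝ᵥ y = ‖WithLp.toLp 2 y‖ ^ 2 := by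
  rw [EuclideanSpace.norm_sq_eq]; simp [dotProduct, sq]

lemma fStat_eq_fRatio (y : Fin n → ℝ) :
    fStat e q x y z = fRatio (diffSpace e q x z) (fullSpace e q x z)ᗮ (WithLp.toLp 2 y) := by
  rw [fStat, fRatio, finrank_diffSpace, finrank_residualSpace,
    norm_sq_starProjection_inf (nullSpace_le_fullSpace e q x z),
    norm_sq_starProjection_orthogonal, Matrix.sub_mulVec, Matrix.sub_mulVec, Matrix.one_mulVec,
    dotProduct_sub, dotProduct_sub, P0, P1, dotProduct_projMatrix, dotProduct_projMatrix,
    dotProduct_self_eq]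

/-- The complement of the null space splits orthogonally into `diffSpace` and the residual space;
only the first part drives the power, and the second will be negligible. -/
lemma signal_eq (f : Fin H → 𝒳 → ℝ) (σ : ℝ≥0) :
    signal e q f σ x z = (‖(diffSpace e q x z).starProjection (WithLp.toLp 2 (meanVec f x z))‖ ^ 2
      + ‖(fullSpace e q x z)ᗮ.starProjection (WithLp.toLp 2 (meanVec f x z))‖ ^ 2) /
      ((σ : ℝ) ^ 2 * √(Module.finrank ℝ (diffSpace e q x z))) := by
  rw [signal, finrank_diffSpace, norm_sq_starProjection_inf (nullSpace_le_fullSpace e q x z),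
    norm_sq_starProjection_orthogonal, Matrix.sub_mulVec, Matrix.one_mulVec,
    dotProduct_sub, P0, dotProduct_projMatrix, dotProduct_self_eq]
  congr 1
  ring

/-- Numerator and denominator are both quadratic, so the random radius of a Gaussian vector is
irrelevant to F. -/
lemma fStat_smul {r : ℝ} (hr : r ≠ 0) (y : Fin n → ℝ) : fStat e q x (r • y) z = fStat e q x y z := by
  have h : r ^ 2 ≠ 0 := by positivity
  rw [fStat_eq_fRatio, fStat_eq_fRatio, fRatio, fRatio, WithLp.toLp_smul]
  simp only [map_smul, norm_smul, mul_pow, Real.norm_eq_abs, sq_abs]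
  rw [mul_div_assoc (r ^ 2) _ (Module.finrank ℝ (diffSpace e q x z) : ℝ),
    mul_div_assoc (r ^ 2) _ (Module.finrank ℝ (fullSpace e q x z)ᗮ : ℝ), mul_div_mul_left _ _ h]

/-- Both projections kill the null space, so F does not see the frozen coordinates. -/
lemma fStat_add_of_mem {w : Fin n → ℝ} (hw : WithLp.toLp 2 w ∈ nullSpace e q x) (y : Fin n → ℝ) :
    fStat e q x (w + y) z = fStat e q x y z := by
  have h1 : (diffSpace e q x z).starProjection (WithLp.toLp 2 w) = 0 :=
    (Submodule.starProjection_apply_eq_zero_iff _).2 <| Submodule.orthogonal_le inf_le_right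
      (Submodule.le_orthogonal_orthogonal _ hw)
  have h2 : (fullSpace e q x z)ᗮ.starProjection (WithLp.toLp 2 w) = 0 :=
    (Submodule.starProjection_apply_eq_zero_iff _).2 <|
      Submodule.le_orthogonal_orthogonal _ (nullSpace_le_fullSpace e q x z hw)
  rw [fStat_eq_fRatio, fStat_eq_fRatio, fRatio, fRatio, WithLp.toLp_add, map_add, map_add, h1, h2,
    zero_add, zero_add]

lemma measurable_fStat : Measurable fun y : Fin n → ℝ => fStat e q x y z := by
  simp_rw [fStat_eq_fRatio, fRatio]
  fun_prop

lemma kernelMatrix_eq :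
    kernelMatrix (kernel e q) x = nullDesign e q x * (nullDesign e q x)ᵀ := by
  ext i j
  simp [kernelMatrix, kernel, nullDesign, Matrix.mul_apply]

variable {e q x}

/-- The leading eigenvectors of the kernel matrix lie in the null space. -/
lemma IsEigenDecomposition.col_mem {Γ : Matrix (Fin n) (Fin n) ℝ} {c : Fin n → ℝ}
    (h : IsEigenDecomposition (kernelMatrix (kernel e q) x) Γ c) {i : Fin n}
    (hi : (i : ℕ) < p0 e q x) : WithLp.toLp 2 (Γ.col i) ∈ nullSpace e q x := by
  classical
  set A := nullDesign e q x
  have hΓ' : Γᵀ * Γ = 1 := (Matrix.mem_orthogonalGroup_iff' (Fin n) ℝ).1 h.orthogonal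
  have hK : A * Aᵀ = Γ * Matrix.diagonal c * Γᵀ := by rw [← h.eq, kernelMatrix_eq]
  have hKΓ : A * (Aᵀ * Γ) = Γ * Matrix.diagonal c := by
    rw [← Matrix.mul_assoc, hK, Matrix.mul_assoc, hΓ', Matrix.mul_one]
  have hdiag : Matrix.diagonal c = (Aᵀ * Γ)ᵀ * (Aᵀ * Γ) := by
    rw [Matrix.transpose_mul, Matrix.transpose_transpose, Matrix.mul_assoc, hKΓ,
      ← Matrix.mul_assoc, hΓ', Matrix.one_mul]
  have hc (j : Fin n) : 0 ≤ c j := by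
    have := congrFun (congrFun hdiag j) j
    rw [Matrix.diagonal_apply_eq, Matrix.mul_apply] at this
    rw [this]
    exact Finset.sum_nonneg fun k _ => mul_self_nonneg _
  -- The kernel matrix is `A Aᵀ`, whose rank equals that of `A`; hence exactly `p₀` eigenvalues are
  -- nonzero.
  have hrank : Fintype.card {j // c j ≠ 0} = p0 e q x := by
    rw [← Matrix.rank_diagonal, p0_eq, ← rank_eq_finrank_colSpace]
    have hu : IsUnit Γ.det := by
      rw [← Matrix.isUnit_iff_isUnit_det]
      exact IsUnit.of_mul_eq_one_right _ hΓ'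
    have hu' : IsUnit Γᵀ.det := by rwa [Matrix.det_transpose]
    rw [← Matrix.rank_self_mul_transpose (nullDesign e q x), hK,
      Matrix.rank_mul_eq_left_of_isUnit_det _ _ hu', Matrix.rank_mul_eq_right_of_isUnit_det _ _ hu]
  -- The eigenvalues are nonnegative and descending, so if `c i` vanished all nonzero ones would
  -- have index below `i`, leaving at most `i < p₀` of them.
  have hci : c i ≠ 0 := by
    intro h0
    have hlt (j : {j // c j ≠ 0}) : (j : Fin n) < i := by
      by_contra! hj
      exact j.2 (le_antisymm ((h.antitone hj).trans h0.le) (hc _))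
    have := Fintype.card_le_of_injective (fun j : {j // c j ≠ 0} => (⟨(j : Fin n), hlt j⟩ : Fin i))
      (fun a b hab => Subtype.ext (Fin.ext (by simpa using hab)))
    rw [Fintype.card_fin] at this
    omega
  -- An eigenvector `γ` with eigenvalue `c ≠ 0` is `A (c⁻¹ Aᵀ γ)`, hence in the column space.
  refine ⟨WithLp.toLp 2 ((c i)⁻¹ • (Aᵀ * Γ).col i), ?_⟩
  ext k
  have := congrFun (congrFun hKΓ k) i
  rw [Matrix.mul_diagonal, Matrix.mul_apply] at this
  rw [Matrix.ofLp_toLpLin, Matrix.toLin'_apply, WithLp.ofLp_toLp, Matrix.mulVec_smul,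
    Pi.smul_apply, smul_eq_mul, inv_mul_eq_iff_eq_mul₀ hci, mul_comm]
  exact this

end Design

/-! ### The `p`-value as a Gaussian tail probability -/

section PValue

variable {n : ℕ}

lemma replaceLast_zero_apply (b : ℕ) (v : EuclideanSpace ℝ (LastCoords n b)) (i : Fin n) :
    replaceLast b 0 v i = if h : n ≤ (i : ℕ) + b then v ⟨i, h⟩ else 0 := rfl

/-- Padding with zeros is adjoint to restriction to the last coordinates. -/
lemma sum_replaceLast_zero (b : ℕ) (v : EuclideanSpace ℝ (LastCoords n b)) (w : Fin n → ℝ) :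
    ∑ i, w i * replaceLast b 0 v i = ∑ i : LastCoords n b, w i * v i := by
  have h : ∀ i : LastCoords n b, w i * v i = w i * replaceLast b 0 v i := fun i => by
    rw [replaceLast_zero_apply, dif_pos i.2]
  rw [Finset.sum_congr rfl fun i _ => h i,
    ← Finset.sum_subtype (Finset.univ.filter fun i : Fin n => n ≤ (i : ℕ) + b) (by simp)
      (fun i => w i * replaceLast b 0 v i), Finset.sum_filter]
  refine Finset.sum_congr rfl fun i _ => ?_
  rw [replaceLast_zero_apply]
  split_ifs <;> simp

lemma measurable_replaceLast (b : ℕ) (w : Fin n → ℝ) : Measurable (replaceLast b w) := by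
  refine measurable_pi_lambda _ fun i => ?_
  unfold replaceLast
  by_cases h : n ≤ (i : ℕ) + b
  · simp only [h, dite_true]; fun_prop
  · simp only [h, dite_false]; fun_prop

/-- The last `b` coordinates of `Γᵀ g` are standard normal if `g` is. -/
lemma stdGaussian_map_lastCoords {Γ : Matrix (Fin n) (Fin n) ℝ}
    (hΓ : Γ ∈ Matrix.orthogonalGroup (Fin n) ℝ) (b : ℕ) :
    (stdGaussian (EuclideanSpace ℝ (Fin n))).map
      (fun g => WithLp.toLp 2 fun i : LastCoords n b => (Γᵀ *ᵥ WithLp.ofLp g) i)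
      = stdGaussian (EuclideanSpace ℝ (LastCoords n b)) := by
  have hΓ' : Γᵀ * Γ = 1 := (Matrix.mem_orthogonalGroup_iff' (Fin n) ℝ).1 hΓ
  refine stdGaussian_map_of_inner ?_ (J := fun t => WithLp.toLp 2 (Γ *ᵥ replaceLast b 0 t)) ?_ ?_
  · simp only [Matrix.mulVec, dotProduct]; fun_prop
  · intro g t
    rw [EuclideanSpace.inner_eq_star_dotProduct, EuclideanSpace.inner_eq_star_dotProduct]
    simp only [star_trivial]
    rw [dotProduct_comm, dotProduct_comm _ (WithLp.ofLp g), Matrix.dotProduct_mulVec,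
      ← Matrix.mulVec_transpose]
    exact (sum_replaceLast_zero b t _).symm
  · intro t
    refine (sq_eq_sq₀ (norm_nonneg _) (norm_nonneg _)).1 ?_
    rw [← dotProduct_self_eq, Matrix.dotProduct_mulVec, ← Matrix.mulVec_transpose,
      Matrix.mulVec_mulVec, hΓ', Matrix.one_mulVec, EuclideanSpace.norm_sq_eq]
    refine (sum_replaceLast_zero b t _).trans (Finset.sum_congr rfl fun i _ => ?_)
    rw [replaceLast_zero_apply, dif_pos i.2, Real.norm_eq_abs, sq_abs, sq]

variable {𝒳 : Type*} {H : ℕ} {e : ℕ → 𝒳 → ℝ} {q : ℕ} {x : Fin n → 𝒳}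
  {Γ : Matrix (Fin n) (Fin n) ℝ} {c : Fin n → ℝ}

/-- Changing the leading coordinates in the eigenbasis does not change the F statistic. -/
lemma fStat_mulVec_congr (h : IsEigenDecomposition (kernelMatrix (kernel e q) x) Γ c)
    (z : Fin n → Fin H) {w w' : Fin n → ℝ}
    (hw : ∀ i : Fin n, n ≤ (i : ℕ) + (n - p0 e q x) → w i = w' i) :
    fStat e q x (Γ *ᵥ w) z = fStat e q x (Γ *ᵥ w') z := by
  have hmem : WithLp.toLp 2 (Γ *ᵥ (w - w')) ∈ nullSpace e q x := by
    have : WithLp.toLp 2 (Γ *ᵥ (w - w')) = ∑ i, (w i - w' i) • WithLp.toLp 2 (Γ.col i) := by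
      ext k
      simp [Matrix.mulVec, dotProduct, mul_comm]
    rw [this]
    refine Submodule.sum_mem _ fun i _ => ?_
    by_cases hi : n ≤ (i : ℕ) + (n - p0 e q x)
    · rw [hw i hi, sub_self, zero_smul]; exact Submodule.zero_mem _
    · exact Submodule.smul_mem _ _ (h.col_mem (by omega))
  have e1 : Γ *ᵥ w = Γ *ᵥ (w - w') + Γ *ᵥ w' := by rw [← Matrix.mulVec_add]; simp
  rw [e1, fStat_add_of_mem e q x z hmem]

/-- The resampled coordinates are the last coordinates of `Γᵀ g` for a Gaussian `g`, scaled to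
length `R`. If `R ≠ 0`, the two invariances of F replace the resampled vector by `g` itself, and no
trace of `Γ` remains. If `R = 0` the resampled vector is `y` itself, which lies in the null space:
then `p = 1` and `F = 0`. -/
lemma fPValue_eq_or (h : IsEigenDecomposition (kernelMatrix (kernel e q) x) Γ c)
    (y : Fin n → ℝ) (z : Fin n → Fin H) :
    (fPValue e q Γ x y z = 1 ∧ fStat e q x y z = 0) ∨ fPValue e q Γ x y z =
      (stdGaussian (EuclideanSpace ℝ (Fin n))).real
        {g | fStat e q x y z ≤ fStat e q x (WithLp.ofLp g) z} := by
  set b := n - p0 e q x with hb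
  set w := Γᵀ *ᵥ y with hw
  set R := √(∑ i : LastCoords n b, w i ^ 2) with hR
  set A : EuclideanSpace ℝ (Fin n) → EuclideanSpace ℝ (LastCoords n b) :=
    fun g => WithLp.toLp 2 fun i => (Γᵀ *ᵥ WithLp.ofLp g) i with hA
  have hΓΓ : Γ * Γᵀ = 1 := (Matrix.mem_orthogonalGroup_iff (Fin n) ℝ).1 h.orthogonal
  have hAm : Measurable A := by
    simp only [hA, Matrix.mulVec, dotProduct]; fun_prop
  have hlaw : (stdGaussian _).map A = stdGaussian _ := stdGaussian_map_lastCoords h.orthogonal b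
  have hTm := measurable_fStat e q x z
  have hset : MeasurableSet {y' | fStat e q x y z ≤ fStat e q x y' z} :=
    measurableSet_le measurable_const hTm
  have hm1 : Measurable fun v => Γ *ᵥ replaceLast b w v :=
    (Continuous.matrix_mulVec continuous_const continuous_id).measurable.comp
      (measurable_replaceLast b w)
  have hp : fPValue e q Γ x y z = (stdGaussian (EuclideanSpace ℝ (Fin n))).real
      {g | fStat e q x y z ≤ fStat e q x (Γ *ᵥ replaceLast b w ((R / ‖A g‖) • A g)) z} := by
    rw [fPValue, permPValue, permLaw, uniformSphere_eq_map_stdGaussian, ← hlaw,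
      Measure.map_map (by fun_prop) hAm, Measure.map_map hm1 (by fun_prop),
      map_measureReal_apply (hm1.comp (by fun_prop)) hset]
    rfl
  have hΓw : Γ *ᵥ w = y := by rw [hw, Matrix.mulVec_mulVec, hΓΓ, Matrix.one_mulVec]
  by_cases hR0 : R = 0
  · left
    have hw0 (i : Fin n) (hi : n ≤ (i : ℕ) + b) : w i = 0 := by
      have h1 := (Real.sqrt_eq_zero (by positivity)).1 hR0
      rw [Finset.sum_eq_zero_iff_of_nonneg (fun i _ => sq_nonneg _)] at h1
      simpa using h1 ⟨i, hi⟩ (Finset.mem_univ _)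
    have hrep (g : EuclideanSpace ℝ (Fin n)) :
        replaceLast b w ((R / ‖A g‖) • A g) = w := by
      ext i
      rw [replaceLast, hR0]
      split_ifs with hi
      · simp [hw0 i hi]
      · rfl
    constructor
    · simp [hp, hrep, hΓw]
    · rw [← hΓw, fStat_mulVec_congr h z (w' := 0) hw0]
      simp [fStat]
  · right
    have hne : Nonempty (LastCoords n b) := by
      by_contra hcon
      rw [not_nonempty_iff] at hcon
      exact hR0 (by simp [hR])
    -- Scaling is harmless only when the factor `R / ‖A g‖` is nonzero, which holds almost surely.
    have hA0 : ∀ᵐ g ∂stdGaussian (EuclideanSpace ℝ (Fin n)), A g ≠ 0 := by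
      have := stdGaussian_singleton_zero (ι := LastCoords n b)
      rw [← hlaw, Measure.map_apply hAm (measurableSet_singleton _)] at this
      exact measure_eq_zero_iff_ae_notMem.1 this
    rw [hp]
    refine measureReal_congr ?_
    filter_upwards [hA0] with g hg
    have hr : R / ‖A g‖ ≠ 0 := div_ne_zero hR0 (norm_ne_zero_iff.2 hg)
    have : fStat e q x (Γ *ᵥ replaceLast b w ((R / ‖A g‖) • A g)) z
        = fStat e q x (WithLp.ofLp g) z := by
      rw [fStat_mulVec_congr h z (w' := (R / ‖A g‖) • Γᵀ *ᵥ WithLp.ofLp g),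
        Matrix.mulVec_smul, Matrix.mulVec_mulVec, hΓΓ, Matrix.one_mulVec, fStat_smul e q x z hr]
      intro i hi
      rw [← hb] at hi
      simp [replaceLast, hi, hA]
    refine propext ?_
    change fStat e q x y z ≤ fStat e q x (Γ *ᵥ replaceLast b w ((R / ‖A g‖) • A g)) z ↔
      fStat e q x y z ≤ fStat e q x (WithLp.ofLp g) z
    rw [this]

end PValue

/-! ### The test at a fixed design -/

section FixedDesign

variable {𝒳 : Type*} {H : ℕ}

/-- The F test rejects when the standardized F statistic exceeds the upper normal quantile, up to a
margin that vanishes as the degrees of freedom grow. -/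
lemma rejection_iff_approx {α : ℝ} (hα : α ∈ Set.Ioo (0 : ℝ) 1) {δ : ℝ} (hδ : 0 < δ) :
    ∃ A : ℕ, ∃ η : ℝ, 0 < η ∧ ∀ {n : ℕ} (e : ℕ → 𝒳 → ℝ) (q : ℕ) (x : Fin n → 𝒳)
      (z : Fin n → Fin H) (y : Fin n → ℝ) {Γ : Matrix (Fin n) (Fin n) ℝ} {c : Fin n → ℝ},
      IsEigenDecomposition (kernelMatrix (kernel e q) x) Γ c →
      A ≤ Module.finrank ℝ (diffSpace e q x z) → 0 < Module.finrank ℝ (diffSpace e q x z) →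
      (Module.finrank ℝ (diffSpace e q x z) : ℝ) ≤ η * Module.finrank ℝ (fullSpace e q x z)ᗮ →
      (-stdNormalQuantile α + δ ≤
          √(Module.finrank ℝ (diffSpace e q x z) / 2) * (fStat e q x y z - 1) →
        fPValue e q Γ x y z ≤ α) ∧
      (fPValue e q Γ x y z ≤ α → -stdNormalQuantile α - δ ≤
          √(Module.finrank ℝ (diffSpace e q x z) / 2) * (fStat e q x y z - 1)) := by
  obtain ⟨hα0, hα1⟩ := hα
  set ζ := stdNormalQuantile α
  have h1 := stdNormalCDF_lt_of_lt_quantile (x := ζ - δ) hα0 (by simp only [ζ]; linarith)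
  have h2 := lt_stdNormalCDF_of_quantile_lt (x := ζ + δ) hα1 (by simp only [ζ]; linarith)
  -- The null tails are taken with `θ = 0`. Their tolerances are the gaps between `α` and `Φ(ζ ∓
  -- δ)`; halving the second keeps the inequality strict.
  obtain ⟨A₁, η₁, hη₁, hA₁⟩ := fRatio_tail (-ζ + δ) 0 (sub_pos.2 h1)
  obtain ⟨A₂, η₂, hη₂, hA₂⟩ := fRatio_tail (-ζ - δ) 0 (half_pos (sub_pos.2 h2))
  -- For `a` this large, `F = 0` puts the standardized statistic below `-ζ + δ`, which rules out the
  -- degenerate case.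
  obtain ⟨A₃, hA₃⟩ := exists_nat_gt (2 * (-ζ + δ) ^ 2)
  refine ⟨max A₁ (max A₂ A₃), min η₁ η₂, lt_min hη₁ hη₂, ?_⟩
  intro n e q x z y Γ c hΓ hA ha hab
  simp only [max_le_iff] at hA
  set a := Module.finrank ℝ (diffSpace e q x z)
  set b := Module.finrank ℝ (fullSpace e q x z)ᗮ
  have hr : 0 < √((a : ℝ) / 2) := Real.sqrt_pos.2 (by positivity)
  have k1 := (hA₁ n (diffSpace e q x z) (fullSpace e q x z)ᗮ 0 hA.1 ha
    (hab.trans (by gcongr; exact min_le_left _ _)) (by simp; positivity)).1 (by simp; positivity)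
  have k2 := (hA₂ n (diffSpace e q x z) (fullSpace e q x z)ᗮ 0 hA.2.1 ha
    (hab.trans (by gcongr; exact min_le_right _ _)) (by simp; positivity)).2
    (by simp only [map_zero, norm_zero, zero_sub]; nlinarith [Real.sqrt_nonneg (a : ℝ)])
  have hF (g : EuclideanSpace ℝ (Fin n)) : fRatio (diffSpace e q x z) (fullSpace e q x z)ᗮ g
      = fStat e q x (WithLp.ofLp g) z := by rw [fStat_eq_fRatio, WithLp.toLp_ofLp]
  simp only [zero_add, zero_div, zero_sub, hF] at k1 k2
  rw [show -(-ζ + δ) = ζ - δ by ring] at k1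
  rw [show -(-ζ - δ) = ζ + δ by ring] at k2
  constructor
  · intro hy
    have hne : fStat e q x y z ≠ 0 := by
      intro h0
      rw [h0] at hy
      have hlt : (-ζ + δ) ^ 2 < a / 2 := by
        have : (A₃ : ℝ) ≤ a := by exact_mod_cast hA.2.2
        linarith
      have := Real.lt_sqrt_of_sq_lt (x := -(-ζ + δ)) (by rwa [neg_sq])
      linarith
    rcases fPValue_eq_or hΓ y z with ⟨-, h0⟩ | hp
    · exact absurd h0 hne
    · rw [hp]
      refine (measureReal_mono ?_).trans (k1.trans (by linarith))
      intro g hg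
      refine hy.trans ?_
      have : fStat e q x y z ≤ fStat e q x (WithLp.ofLp g) z := hg
      exact mul_le_mul_of_nonneg_left (by linarith) hr.le
  · intro hpα
    by_contra! hlt
    rcases fPValue_eq_or hΓ y z with ⟨h1, -⟩ | hp
    · linarith
    · rw [hp] at hpα
      have : (stdGaussian (EuclideanSpace ℝ (Fin n))).real
          {g | -ζ - δ ≤ √((a : ℝ) / 2) * (fStat e q x (WithLp.ofLp g) z - 1)} ≤ _ :=
        (measureReal_mono (fun g hg => ?_)).trans hpα
      · linarith
      · have h3 : -ζ - δ ≤ √((a : ℝ) / 2) * (fStat e q x (WithLp.ofLp g) z - 1) := hg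
        have h4 := lt_of_mul_lt_mul_left (hlt.trans_le h3) hr.le
        change fStat e q x y z ≤ fStat e q x (WithLp.ofLp g) z
        linarith

/-- Gaussian noise with variance `σ²` reduces to standard Gaussian noise. -/
lemma pi_gaussianReal_fStat_tail {n : ℕ} (e : ℕ → 𝒳 → ℝ) (q : ℕ) (x : Fin n → 𝒳)
    (z : Fin n → Fin H) (u : Fin n → ℝ) {σ : ℝ≥0} (hσ : 0 < σ) (r t : ℝ) :
    (Measure.pi fun _ : Fin n => gaussianReal 0 (σ ^ 2)).real
        {ε | t ≤ r * (fStat e q x (u + ε) z - 1)}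
      = (stdGaussian (EuclideanSpace ℝ (Fin n))).real
        {g | t ≤ r * (fRatio (diffSpace e q x z) (fullSpace e q x z)ᗮ
          (WithLp.toLp 2 ((σ : ℝ)⁻¹ • u) + g) - 1)} := by
  have hσ' : (σ : ℝ) ≠ 0 := by exact_mod_cast hσ.ne'
  have h1 : (Measure.pi fun _ : Fin n => gaussianReal 0 (σ ^ 2))
      = (Measure.pi fun _ : Fin n => gaussianReal 0 1).map fun g i => (σ : ℝ) * g i := by
    rw [Measure.pi_map_pi (f := fun _ x => (σ : ℝ) * x) (fun _ => by fun_prop)]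
    congr 1
    ext1 i
    rw [gaussianReal_map_const_mul]
    congr 1
    · simp
    · ext; simp
  have hm := measurable_fStat e q x z
  have hm' : Measurable fun ε : Fin n → ℝ => r * (fStat e q x (u + ε) z - 1) :=
    ((hm.comp (by fun_prop)).sub_const 1).const_mul r
  rw [h1, map_measureReal_apply (by fun_prop) (measurableSet_le measurable_const hm'),
    ← map_pi_eq_stdGaussian, map_measureReal_apply (by fun_prop)]
  · congr 1
    ext g
    simp only [Set.mem_preimage, Set.mem_ofPred_eq]
    rw [← WithLp.toLp_add, ← fStat_eq_fRatio, ← fStat_smul e q x z hσ' ((σ : ℝ)⁻¹ • u + g),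
      smul_add, smul_inv_smul₀ hσ']
    rfl
  · refine measurableSet_le measurable_const ?_
    unfold fRatio
    fun_prop

end FixedDesign

/-! ### Measurability of projections -/

section Measurability

variable {Ω : Type*} [MeasurableSpace Ω] {n : ℕ} {κ : Type*} [Fintype κ] [DecidableEq κ]

/-- The projection is not continuous in the matrix where the rank jumps. The distance to the column
space, however, is an infimum over coefficient vectors, and a countable dense set of them suffices.
-/
lemma measurable_norm_sub_starProjection {A : Ω → Matrix (Fin n) κ ℝ}
    (hA : ∀ i j, Measurable fun ω => A ω i j) {y : Ω → EuclideanSpace ℝ (Fin n)}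
    (hy : Measurable y) :
    Measurable fun ω => ‖y ω - (colSpace (A ω)).starProjection (y ω)‖ := by
  refine measurable_of_Iio fun r => ?_
  have hset : (fun ω => ‖y ω - (colSpace (A ω)).starProjection (y ω)‖) ⁻¹' Set.Iio r
      = ⋃ k : ℕ, {ω | ‖y ω - Matrix.toEuclideanLin (A ω)
        (TopologicalSpace.denseSeq (EuclideanSpace ℝ κ) k)‖ < r} := by
    ext ω
    simp only [Set.mem_preimage, Set.mem_Iio, Set.mem_iUnion, Set.mem_ofPred_eq]
    constructor
    · intro h
      obtain ⟨b, hb⟩ : (colSpace (A ω)).starProjection (y ω) ∈ colSpace (A ω) :=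
        Submodule.starProjection_apply_mem _ _
      have hopen : IsOpen {b : EuclideanSpace ℝ κ | ‖y ω - Matrix.toEuclideanLin (A ω) b‖ < r} :=
        isOpen_lt ((continuous_const.sub (LinearMap.continuous_of_finiteDimensional _)).norm)
          continuous_const
      obtain ⟨_, h2, k, rfl⟩ := (TopologicalSpace.denseRange_denseSeq _).inter_open_nonempty _ hopen
        ⟨b, by simpa [hb] using h⟩
      exact ⟨k, h2⟩
    · rintro ⟨k, hk⟩
      refine lt_of_le_of_lt ?_ hk
      rw [Submodule.starProjection_minimal]
      exact ciInf_le ⟨0, by rintro _ ⟨_, rfl⟩; positivity⟩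
        (⟨_, LinearMap.mem_range_self _ _⟩ : colSpace (A ω))
  rw [hset]
  refine MeasurableSet.iUnion fun k => measurableSet_lt ?_ measurable_const
  refine (hy.sub ?_).norm
  have : ∀ ω, Matrix.toEuclideanLin (A ω) (TopologicalSpace.denseSeq (EuclideanSpace ℝ κ) k)
      = WithLp.toLp 2 fun i => ∑ j, A ω i j * TopologicalSpace.denseSeq (EuclideanSpace ℝ κ) k j :=
    fun ω => by ext i; rw [Matrix.ofLp_toLpLin]; rfl
  simp_rw [this]
  fun_prop

lemma measurable_norm_sq_starProjection {A : Ω → Matrix (Fin n) κ ℝ}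
    (hA : ∀ i j, Measurable fun ω => A ω i j) {y : Ω → EuclideanSpace ℝ (Fin n)}
    (hy : Measurable y) :
    Measurable fun ω => ‖(colSpace (A ω)).starProjection (y ω)‖ ^ 2 := by
  have h (ω : Ω) : ‖(colSpace (A ω)).starProjection (y ω)‖ ^ 2
      = ‖y ω‖ ^ 2 - ‖y ω - (colSpace (A ω)).starProjection (y ω)‖ ^ 2 := by
    rw [← Submodule.starProjection_orthogonal_val, norm_sq_starProjection_orthogonal]
    ring
  simp_rw [h]
  exact (hy.norm.pow_const 2).sub ((measurable_norm_sub_starProjection hA hy).pow_const 2)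

/-- The dimension is the trace of the projection, so measurability of ranks follows from that of
projected lengths. -/
lemma finrank_eq_sum_norm_sq (V : Submodule ℝ (EuclideanSpace ℝ (Fin n))) :
    (Module.finrank ℝ V : ℝ) = ∑ i, ‖V.starProjection (EuclideanSpace.basisFun (Fin n) ℝ i)‖ ^ 2 := by
  have hp : LinearMap.IsProj V (V.starProjection : EuclideanSpace ℝ (Fin n) →ₗ[ℝ] _) :=
    ⟨fun v => Submodule.starProjection_apply_mem _ v,
      fun v hv => Submodule.starProjection_eq_self_iff.2 hv⟩
  rw [← hp.trace, LinearMap.trace_eq_sum_inner _ (EuclideanSpace.basisFun (Fin n) ℝ)]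
  refine Finset.sum_congr rfl fun i _ => ?_
  rw [← real_inner_self_eq_norm_sq, Submodule.inner_starProjection_left_eq_right,
    Submodule.starProjection_eq_self_iff.2 (Submodule.starProjection_apply_mem _ _)]
  rfl

lemma measurable_finrank_colSpace {A : Ω → Matrix (Fin n) κ ℝ}
    (hA : ∀ i j, Measurable fun ω => A ω i j) :
    Measurable fun ω => (Module.finrank ℝ (colSpace (A ω)) : ℝ) := by
  simp_rw [finrank_eq_sum_norm_sq]
  exact Finset.measurable_sum _ fun i _ => measurable_norm_sq_starProjection hA measurable_const

end Measurability

/-! ### Random designs -/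

section RandomDesign

variable {𝒳 : Type*} {n H : ℕ} {e : ℕ → 𝒳 → ℝ} {q : ℕ} {f : Fin H → 𝒳 → ℝ}

variable (n e q f) in
/-- The designs with enough degrees of freedom and a small approximation error. -/
def regularDesigns (σ : ℝ≥0) (A : ℕ) (η : ℝ) : Set ((Fin n → 𝒳) × (Fin n → Fin H)) :=
  {w | A ≤ Module.finrank ℝ (diffSpace e q w.1 w.2) ∧
    0 < Module.finrank ℝ (diffSpace e q w.1 w.2) ∧
    (Module.finrank ℝ (diffSpace e q w.1 w.2) : ℝ)
      ≤ η * Module.finrank ℝ (fullSpace e q w.1 w.2)ᗮ ∧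
    ‖(fullSpace e q w.1 w.2)ᗮ.starProjection (WithLp.toLp 2 (meanVec f w.1 w.2))‖ ^ 2
      ≤ η * ((σ : ℝ) ^ 2 * √(Module.finrank ℝ (diffSpace e q w.1 w.2)))}

variable (n e q f) in
/-- The designs with signal at least `s`, up to the approximation error. -/
def strongDesigns (σ : ℝ≥0) (s : ℝ) : Set ((Fin n → 𝒳) × (Fin n → Fin H)) :=
  {w | s * ((σ : ℝ) ^ 2 * √(Module.finrank ℝ (diffSpace e q w.1 w.2)))
    ≤ ‖(diffSpace e q w.1 w.2).starProjection (WithLp.toLp 2 (meanVec f w.1 w.2))‖ ^ 2}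

variable (n e q f) in
/-- The designs with signal at most `s`, up to the approximation error. -/
def weakDesigns (σ : ℝ≥0) (s : ℝ) : Set ((Fin n → 𝒳) × (Fin n → Fin H)) :=
  {w | ‖(diffSpace e q w.1 w.2).starProjection (WithLp.toLp 2 (meanVec f w.1 w.2))‖ ^ 2
    ≤ s * ((σ : ℝ) ^ 2 * √(Module.finrank ℝ (diffSpace e q w.1 w.2)))}

lemma regularDesigns_mono (σ : ℝ≥0) {A A' : ℕ} {η η' : ℝ} (hA : A ≤ A') (hη : η' ≤ η) :
    regularDesigns n e q f σ A' η' ⊆ regularDesigns n e q f σ A η := by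
  rintro w ⟨h1, h2, h3, h4⟩
  exact ⟨hA.trans h1, h2, h3.trans (by gcongr), h4.trans (by gcongr)⟩

lemma weakDesigns_mono (σ : ℝ≥0) {s s' : ℝ} (hs : s ≤ s') :
    weakDesigns n e q f σ s ⊆ weakDesigns n e q f σ s' :=
  fun _ hw => le_trans hw (mul_le_mul_of_nonneg_right hs (by positivity))

lemma strongDesigns_mono (σ : ℝ≥0) {s s' : ℝ} (hs : s ≤ s') :
    strongDesigns n e q f σ s' ⊆ strongDesigns n e q f σ s :=
  fun _ hw => le_trans (mul_le_mul_of_nonneg_right hs (by positivity)) hw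

variable (n e q f) in
/-- The event that the standardized F statistic is at least `t`. -/
def exceedance (t : ℝ) : Set (((Fin n → 𝒳) × (Fin n → Fin H)) × (Fin n → ℝ)) :=
  {p | t ≤ √(Module.finrank ℝ (diffSpace e q p.1.1 p.1.2) / 2) *
    (fStat e q p.1.1 (meanVec f p.1.1 p.1.2 + p.2) p.1.2 - 1)}

/-- Asymptotic probability of `exceedance` given a regular design. -/
lemma exceedance_section (t θ : ℝ) {δ : ℝ} (hδ : 0 < δ) : ∃ A : ℕ, ∃ η : ℝ, 0 < η ∧
    ∀ (n : ℕ) (e : ℕ → 𝒳 → ℝ) (q : ℕ) (f : Fin H → 𝒳 → ℝ) (σ : ℝ≥0), 0 < σ →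
    ∀ w ∈ regularDesigns n e q f σ A η,
      (w ∈ weakDesigns n e q f σ (θ + η) →
        (Measure.pi fun _ : Fin n => gaussianReal 0 (σ ^ 2)).real
          {ε | (w, ε) ∈ exceedance n e q f t} ≤ stdNormalCDF (θ / √2 - t) + δ) ∧
      (w ∈ strongDesigns n e q f σ (θ - η) →
        stdNormalCDF (θ / √2 - t) - δ ≤
        (Measure.pi fun _ : Fin n => gaussianReal 0 (σ ^ 2)).real
          {ε | (w, ε) ∈ exceedance n e q f t}) := by
  obtain ⟨A, η, hη, h⟩ := fRatio_tail t θ hδ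
  refine ⟨A, η, hη, fun n e q f σ hσ w hw => ?_⟩
  obtain ⟨h1, h2, h3, h4⟩ := hw
  have hσ' : (0 : ℝ) < (σ : ℝ) ^ 2 := by positivity
  have hscale (V : Submodule ℝ (EuclideanSpace ℝ (Fin n))) :
      ‖V.starProjection (WithLp.toLp 2 ((σ : ℝ)⁻¹ • meanVec f w.1 w.2))‖ ^ 2
      = ‖V.starProjection (WithLp.toLp 2 (meanVec f w.1 w.2))‖ ^ 2 / (σ : ℝ) ^ 2 := by
    rw [WithLp.toLp_smul, map_smul, norm_smul, mul_pow, Real.norm_eq_abs, sq_abs, inv_pow]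
    field_simp
  obtain ⟨k1, k2⟩ := h n (diffSpace e q w.1 w.2) (fullSpace e q w.1 w.2)ᗮ
    (WithLp.toLp 2 ((σ : ℝ)⁻¹ • meanVec f w.1 w.2)) h1 h2 h3
    (by rw [hscale, div_le_iff₀ hσ']; linarith)
  have hE : (Measure.pi fun _ : Fin n => gaussianReal 0 (σ ^ 2)).real
      {ε | (w, ε) ∈ exceedance n e q f t} = _ :=
    pi_gaussianReal_fStat_tail e q w.1 w.2 (meanVec f w.1 w.2) hσ
      (√(Module.finrank ℝ (diffSpace e q w.1 w.2) / 2)) t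
  rw [hE]
  constructor
  · intro hw
    refine k1 ?_
    rw [hscale, div_le_iff₀ hσ']
    exact le_of_le_of_eq hw (by ring)
  · intro hw
    refine k2 ?_
    rw [hscale, le_div_iff₀ hσ']
    exact le_of_eq_of_le (by ring) hw

/-! ### Measurability in the design, and integration over it. -/

variable [MeasurableSpace 𝒳]

section MeasurableDesign

variable {Ω : Type*} [MeasurableSpace Ω] {x : Ω → Fin n → 𝒳} {z : Ω → Fin n → Fin H}

lemma measurable_nullDesign (he : ∀ j, Measurable (e j)) (hx : Measurable x) (i : Fin n)
    (j : Fin q) : Measurable fun ω => nullDesign e q (x ω) i j :=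
  (he j).comp ((measurable_pi_apply i).comp hx)

lemma measurable_fullDesign (he : ∀ j, Measurable (e j)) (hx : Measurable x) (hz : Measurable z)
    (i : Fin n) (j : Fin H × Fin q) : Measurable fun ω => fullDesign e q (x ω) (z ω) i j :=
  Measurable.ite (((measurable_pi_apply i).comp hz) (measurableSet_singleton j.1))
    ((he j.2).comp ((measurable_pi_apply i).comp hx)) measurable_const

lemma measurable_meanVec (hf : ∀ h, Measurable (f h)) (hx : Measurable x) (hz : Measurable z) :
    Measurable fun ω => meanVec f (x ω) (z ω) := by
  refine measurable_pi_lambda _ fun i => ?_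
  have h (ω : Ω) : meanVec f (x ω) (z ω) i = ∑ h, if z ω i = h then f h (x ω i) else 0 := by
    simp [meanVec]
  simp_rw [h]
  exact Finset.measurable_sum _ fun h _ =>
    Measurable.ite (((measurable_pi_apply i).comp hz) (measurableSet_singleton h))
      ((hf h).comp ((measurable_pi_apply i).comp hx)) measurable_const

lemma measurable_finrank_diffSpace (he : ∀ j, Measurable (e j)) (hx : Measurable x)
    (hz : Measurable z) :
    Measurable fun ω => (Module.finrank ℝ (diffSpace e q (x ω) (z ω)) : ℝ) := by
  simp_rw [finrank_diffSpace, p0_eq, p1_eq]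
  exact (measurable_finrank_colSpace (measurable_fullDesign he hx hz)).sub
    (measurable_finrank_colSpace (measurable_nullDesign he hx))

lemma measurable_finrank_residualSpace (he : ∀ j, Measurable (e j)) (hx : Measurable x)
    (hz : Measurable z) :
    Measurable fun ω => (Module.finrank ℝ (fullSpace e q (x ω) (z ω))ᗮ : ℝ) := by
  simp_rw [finrank_residualSpace, p1_eq]
  exact measurable_const.sub (measurable_finrank_colSpace (measurable_fullDesign he hx hz))

lemma measurable_norm_sq_diffSpace (he : ∀ j, Measurable (e j)) (hx : Measurable x)
    (hz : Measurable z) {y : Ω → EuclideanSpace ℝ (Fin n)} (hy : Measurable y) :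
    Measurable fun ω => ‖(diffSpace e q (x ω) (z ω)).starProjection (y ω)‖ ^ 2 := by
  simp_rw [norm_sq_starProjection_inf (nullSpace_le_fullSpace e q _ _)]
  exact (measurable_norm_sq_starProjection (measurable_fullDesign he hx hz) hy).sub
    (measurable_norm_sq_starProjection (measurable_nullDesign he hx) hy)

lemma measurable_norm_sq_residualSpace (he : ∀ j, Measurable (e j)) (hx : Measurable x)
    (hz : Measurable z) {y : Ω → EuclideanSpace ℝ (Fin n)} (hy : Measurable y) :
    Measurable fun ω => ‖(fullSpace e q (x ω) (z ω))ᗮ.starProjection (y ω)‖ ^ 2 := by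
  simp_rw [norm_sq_starProjection_orthogonal]
  exact (hy.norm.pow_const 2).sub
    (measurable_norm_sq_starProjection (measurable_fullDesign he hx hz) hy)

lemma measurable_fStat_joint (he : ∀ j, Measurable (e j)) (hx : Measurable x)
    (hz : Measurable z) {y : Ω → Fin n → ℝ} (hy : Measurable y) :
    Measurable fun ω => fStat e q (x ω) (y ω) (z ω) := by
  have hy' : Measurable fun ω => WithLp.toLp 2 (y ω) := by fun_prop
  simp_rw [fStat_eq_fRatio, fRatio]
  exact ((measurable_norm_sq_diffSpace he hx hz hy').div
    (measurable_finrank_diffSpace he hx hz)).div ((measurable_norm_sq_residualSpace he hx hz hy').div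
    (measurable_finrank_residualSpace he hx hz))

end MeasurableDesign

lemma measurableSet_regularDesigns (he : ∀ j, Measurable (e j)) (hf : ∀ h, Measurable (f h))
    (σ : ℝ≥0) (A : ℕ) (η : ℝ) : MeasurableSet (regularDesigns n e q f σ A η) := by
  have ha := measurable_finrank_diffSpace (q := q) he
    (measurable_fst : Measurable fun w : (Fin n → 𝒳) × (Fin n → Fin H) => w.1) measurable_snd
  have hb := measurable_finrank_residualSpace (q := q) he
    (measurable_fst : Measurable fun w : (Fin n → 𝒳) × (Fin n → Fin H) => w.1) measurable_snd
  have hm : Measurable fun w : (Fin n → 𝒳) × (Fin n → Fin H) =>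
      WithLp.toLp 2 (meanVec f w.1 w.2) := by
    have := measurable_meanVec (n := n) hf measurable_fst measurable_snd
    fun_prop
  have hs := measurable_norm_sq_residualSpace (q := q) he measurable_fst measurable_snd hm
  have h : regularDesigns n e q f σ A η =
      {w | (A : ℝ) ≤ Module.finrank ℝ (diffSpace e q w.1 w.2)} ∩
      ({w | (0 : ℝ) < Module.finrank ℝ (diffSpace e q w.1 w.2)} ∩
      ({w | (Module.finrank ℝ (diffSpace e q w.1 w.2) : ℝ)
        ≤ η * Module.finrank ℝ (fullSpace e q w.1 w.2)ᗮ} ∩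
      {w | ‖(fullSpace e q w.1 w.2)ᗮ.starProjection (WithLp.toLp 2 (meanVec f w.1 w.2))‖ ^ 2
        ≤ η * ((σ : ℝ) ^ 2 * √(Module.finrank ℝ (diffSpace e q w.1 w.2)))})) := by
    ext w
    simp only [regularDesigns, Set.mem_inter_iff, Set.mem_ofPred_eq, Nat.cast_le, Nat.cast_pos]
  rw [h]
  exact (measurableSet_le measurable_const ha).inter ((measurableSet_lt measurable_const ha).inter
    ((measurableSet_le ha (hb.const_mul η)).inter
      (measurableSet_le hs ((ha.sqrt.const_mul _).const_mul _))))

lemma measurable_signal_diff (he : ∀ j, Measurable (e j)) (hf : ∀ h, Measurable (f h)) :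
    Measurable fun w : (Fin n → 𝒳) × (Fin n → Fin H) =>
      ‖(diffSpace e q w.1 w.2).starProjection (WithLp.toLp 2 (meanVec f w.1 w.2))‖ ^ 2 := by
  have := measurable_meanVec (n := n) hf measurable_fst measurable_snd
  exact measurable_norm_sq_diffSpace he measurable_fst measurable_snd (by fun_prop)

lemma measurableSet_strongDesigns (he : ∀ j, Measurable (e j)) (hf : ∀ h, Measurable (f h))
    (σ : ℝ≥0) (s : ℝ) : MeasurableSet (strongDesigns n e q f σ s) :=
  measurableSet_le (((measurable_finrank_diffSpace he measurable_fst
    measurable_snd).sqrt.const_mul _).const_mul _) (measurable_signal_diff he hf)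

lemma measurableSet_weakDesigns (he : ∀ j, Measurable (e j)) (hf : ∀ h, Measurable (f h))
    (σ : ℝ≥0) (s : ℝ) : MeasurableSet (weakDesigns n e q f σ s) :=
  measurableSet_le (measurable_signal_diff he hf) (((measurable_finrank_diffSpace he measurable_fst
    measurable_snd).sqrt.const_mul _).const_mul _)

lemma measurableSet_exceedance (he : ∀ j, Measurable (e j)) (hf : ∀ h, Measurable (f h)) (t : ℝ) :
    MeasurableSet (exceedance n e q f t) := by
  have hx : Measurable fun p : ((Fin n → 𝒳) × (Fin n → Fin H)) × (Fin n → ℝ) => p.1.1 := by fun_prop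
  have hz : Measurable fun p : ((Fin n → 𝒳) × (Fin n → Fin H)) × (Fin n → ℝ) => p.1.2 := by fun_prop
  exact measurableSet_le measurable_const
    (((measurable_finrank_diffSpace he hx hz).div_const 2).sqrt.mul
    ((measurable_fStat_joint he hx hz
      ((measurable_meanVec hf hx hz).add measurable_snd)).sub_const 1))

/-- Tonelli's theorem, with sections outside `G` bounded by one. -/
lemma prod_real_le_of_section {α β : Type*} [MeasurableSpace α] [MeasurableSpace β]
    (ρ : Measure α) (π : Measure β) [IsProbabilityMeasure ρ] [IsProbabilityMeasure π]
    {E : Set (α × β)} (hE : MeasurableSet E) {G : Set α} {c : ℝ} (hc : 0 ≤ c)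
    (h : ∀ a ∈ G, π.real {b | (a, b) ∈ E} ≤ c) : (ρ.prod π).real E ≤ c + ρ.real Gᶜ := by
  have h1 : ρ.prod π E ≤ ENNReal.ofReal c + ρ Gᶜ := by
    rw [Measure.prod_apply hE]
    calc ∫⁻ a, π (Prod.mk a ⁻¹' E) ∂ρ ≤ ∫⁻ a, ENNReal.ofReal c + Gᶜ.indicator 1 a ∂ρ := by
          refine lintegral_mono fun a => ?_
          by_cases ha : a ∈ G
          · refine le_add_right ?_
            exact ENNReal.le_ofReal_iff_toReal_le (measure_ne_top _ _) hc |>.2 (h a ha)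
          · simp only [Set.indicator_of_mem (Set.mem_compl ha), Pi.one_apply]
            exact le_add_left prob_le_one
      _ ≤ ENNReal.ofReal c + ρ Gᶜ := by
          rw [lintegral_add_left measurable_const]
          simpa using lintegral_indicator_one_le Gᶜ
  have h2 := ENNReal.toReal_mono (by finiteness) h1
  rwa [ENNReal.toReal_add (by finiteness) (by finiteness), ENNReal.toReal_ofReal hc] at h2

/-- Bounds for the rejection probability under the alternative model. -/
theorem rejection_probability {α : ℝ} (hα : α ∈ Set.Ioo (0 : ℝ) 1) (θ : ℝ) {δ : ℝ} (hδ : 0 < δ) :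
    ∃ A : ℕ, ∃ η : ℝ, 0 < η ∧ ∀ (n : ℕ) (e : ℕ → 𝒳 → ℝ) (q : ℕ) (f : Fin H → 𝒳 → ℝ) (σ : ℝ≥0),
      0 < σ → (∀ j, Measurable (e j)) → (∀ h, Measurable (f h)) →
      ∀ {Ω : Type*} [MeasurableSpace Ω] (P : Measure Ω) [IsProbabilityMeasure P] (μ : Measure 𝒳)
        (X : Ω → Fin n → 𝒳) (Y : Ω → Fin n → ℝ) (Z : Ω → Fin n → Fin H) (ε : Ω → Fin n → ℝ)
        (Γ : (Fin n → 𝒳) → Matrix (Fin n) (Fin n) ℝ) (c : (Fin n → 𝒳) → Fin n → ℝ),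
      IsSampleH1 P μ f σ X Y Z ε →
      (∀ x, IsEigenDecomposition (kernelMatrix (kernel e q) x) (Γ x) (c x)) →
      (P.real {ω | fPValue e q (Γ (X ω)) (X ω) (Y ω) (Z ω) ≤ α}
        ≤ stdNormalCDF (stdNormalQuantile α + θ / √2) + δ + 2 * P.real
          {ω | (X ω, Z ω) ∉ regularDesigns n e q f σ A η ∩ weakDesigns n e q f σ (θ + η)}) ∧
      (stdNormalCDF (stdNormalQuantile α + θ / √2) - δ - 2 * P.real
          {ω | (X ω, Z ω) ∉ regularDesigns n e q f σ A η ∩ strongDesigns n e q f σ (θ - η)}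
        ≤ P.real {ω | fPValue e q (Γ (X ω)) (X ω) (Y ω) (Z ω) ≤ α}) := by
  set ζ := stdNormalQuantile α
  set Φ := stdNormalCDF (ζ + θ / √2)
  -- Continuity of the normal distribution function absorbs the margin `δ'` in the critical value
  -- into half of `δ`.
  obtain ⟨δ', hδ', hup, hlow⟩ : ∃ δ' : ℝ, 0 < δ' ∧ stdNormalCDF (θ / √2 - (-ζ - δ')) < Φ + δ / 2 ∧
      Φ - δ / 2 < stdNormalCDF (θ / √2 - (-ζ + δ')) := by
    have c1 : Continuous fun r : ℝ => stdNormalCDF (θ / √2 - (-ζ - r)) :=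
      continuous_stdNormalCDF.comp (by fun_prop)
    have c2 : Continuous fun r : ℝ => stdNormalCDF (θ / √2 - (-ζ + r)) :=
      continuous_stdNormalCDF.comp (by fun_prop)
    have e0 : θ / √2 - -ζ = ζ + θ / √2 := by ring
    have h1 := (c1.tendsto 0).eventually_lt_const (u := Φ + δ / 2)
      (by rw [sub_zero, e0]; simp only [Φ]; linarith)
    have h2 := (c2.tendsto 0).eventually_const_lt (u := Φ - δ / 2)
      (by rw [add_zero, e0]; simp only [Φ]; linarith)
    obtain ⟨r, ⟨h1, h2⟩, h3⟩ := ((h1.and h2).filter_mono nhdsWithin_le_nhds).and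
      (self_mem_nhdsWithin : Set.Ioi (0 : ℝ) ∈ 𝓝[>] 0) |>.exists
    exact ⟨r, h3, h1, h2⟩
  obtain ⟨A₁, η₁, hη₁, hrej⟩ := rejection_iff_approx (𝒳 := 𝒳) (H := H) hα hδ'
  obtain ⟨A₂, η₂, hη₂, hex₂⟩ := exceedance_section (𝒳 := 𝒳) (H := H) (-ζ - δ') θ (half_pos hδ)
  obtain ⟨A₃, η₃, hη₃, hex₃⟩ := exceedance_section (𝒳 := 𝒳) (H := H) (-ζ + δ') θ (half_pos hδ)
  set A := max A₁ (max A₂ A₃)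
  set η := min η₁ (min η₂ η₃)
  have hA₁ : A₁ ≤ A := le_max_left _ _
  have hA₂ : A₂ ≤ A := (le_max_left _ _).trans (le_max_right _ _)
  have hA₃ : A₃ ≤ A := (le_max_right _ _).trans (le_max_right _ _)
  have hη₁' : η ≤ η₁ := min_le_left _ _
  have hη₂' : η ≤ η₂ := (min_le_right _ _).trans (min_le_left _ _)
  have hη₃' : η ≤ η₃ := (min_le_right _ _).trans (min_le_right _ _)
  refine ⟨A, η, lt_min hη₁ (lt_min hη₂ hη₃), ?_⟩
  intro n e q f σ hσ he hf Ω _ P _ μ X Y Z ε Γ c hS hΓ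
  have hY (ω : Ω) : Y ω = meanVec f (X ω) (Z ω) + ε ω := funext fun i => hS.model ω i
  have hXZ : Measurable fun ω => (X ω, Z ω) := hS.measurable_X.prodMk hS.measurable_Z
  have hmε := hS.measurable_noise
  have hlaw : P.map (fun ω => ((X ω, Z ω), ε ω)) = (P.map fun ω => (X ω, Z ω)).prod
      (Measure.pi fun _ : Fin n => gaussianReal 0 (σ ^ 2)) := by
    rw [(indepFun_iff_map_prod_eq_prod_map_map hXZ.aemeasurable hmε.aemeasurable).1 hS.indep_noise]
    congr 1
    have := (iIndepFun_iff_map_fun_eq_pi_map (fun i => by fun_prop)).1 hS.iIndep_noise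
    simp only [hS.law_noise] at this
    exact this
  have : IsProbabilityMeasure (P.map fun ω => (X ω, Z ω)) :=
    Measure.isProbabilityMeasure_map hXZ.aemeasurable
  have key (E : Set (((Fin n → 𝒳) × (Fin n → Fin H)) × (Fin n → ℝ))) (hE : MeasurableSet E)
      (G : Set ((Fin n → 𝒳) × (Fin n → Fin H))) (hG : MeasurableSet G) (r : ℝ) (hr : 0 ≤ r)
      (h : ∀ w ∈ G, (Measure.pi fun _ : Fin n => gaussianReal 0 (σ ^ 2)).real
        {v | (w, v) ∈ E} ≤ r) :
      P.real {ω | ((X ω, Z ω), ε ω) ∈ E} ≤ r + P.real {ω | (X ω, Z ω) ∉ G} := by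
    have h1 := prod_real_le_of_section (P.map fun ω => (X ω, Z ω))
      (Measure.pi fun _ : Fin n => gaussianReal 0 (σ ^ 2)) hE hr h
    rwa [← hlaw, map_measureReal_apply (hXZ.prodMk hmε) hE,
      map_measureReal_apply hXZ hG.compl] at h1
  have hreg := measurableSet_regularDesigns (n := n) (q := q) he hf σ A η
  have hΦ0 : 0 ≤ Φ := by simp only [Φ, stdNormalCDF_eq]; positivity
  have hΦ1 : Φ ≤ 1 := by simp only [Φ, stdNormalCDF_eq]; exact measureReal_le_one
  constructor
  · have h1 := key (exceedance n e q f (-ζ - δ')) (measurableSet_exceedance he hf _)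
      _ (hreg.inter (measurableSet_weakDesigns he hf σ (θ + η))) (Φ + δ) (by linarith)
      fun w hw => ((hex₂ n e q f σ hσ w (regularDesigns_mono σ hA₂ hη₂' hw.1)).1
        (weakDesigns_mono σ (by linarith) hw.2)).trans (by linarith)
    have hsub : {ω | fPValue e q (Γ (X ω)) (X ω) (Y ω) (Z ω) ≤ α} ⊆
        {ω | ((X ω, Z ω), ε ω) ∈ exceedance n e q f (-ζ - δ')} ∪
        {ω | (X ω, Z ω) ∉ regularDesigns n e q f σ A η ∩ weakDesigns n e q f σ (θ + η)} := by
      intro ω hω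
      by_cases hG : (X ω, Z ω) ∈ regularDesigns n e q f σ A η ∩ weakDesigns n e q f σ (θ + η)
      · left
        obtain ⟨r1, r2, r3, -⟩ := regularDesigns_mono σ hA₁ hη₁' hG.1
        have := (hrej e q (X ω) (Z ω) (Y ω) (hΓ (X ω)) r1 r2 r3).2 hω
        rwa [hY] at this
      · exact Or.inr hG
    -- Bad designs are counted twice, once in this inclusion and once in the integration over
    -- designs; hence the factor 2.
    have h2 := (measureReal_mono (μ := P) hsub).trans (measureReal_union_le _ _)
    linarith
  · have h1 := key (exceedance n e q f (-ζ + δ'))ᶜ (measurableSet_exceedance he hf _).compl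
      _ (hreg.inter (measurableSet_strongDesigns he hf σ (θ - η))) (1 - Φ + δ) (by linarith)
      fun w hw => by
        have h3 := (hex₃ n e q f σ hσ w (regularDesigns_mono σ hA₃ hη₃' hw.1)).2
          (strongDesigns_mono σ (by linarith) hw.2)
        have hms : MeasurableSet {v | (w, v) ∈ exceedance n e q f (-ζ + δ')} :=
          measurable_prodMk_left (measurableSet_exceedance he hf (-ζ + δ'))
        have h4 := probReal_compl_eq_one_sub
          (μ := Measure.pi fun _ : Fin n => gaussianReal 0 (σ ^ 2)) hms
        have h5 : {v | (w, v) ∈ (exceedance n e q f (-ζ + δ'))ᶜ}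
          = {v | (w, v) ∈ exceedance n e q f (-ζ + δ')}ᶜ := rfl
        rw [h5, h4]
        linarith
    -- Covering the whole space uses only subadditivity, so the rejection event need not be shown
    -- measurable.
    have hsub : (Set.univ : Set Ω) ⊆ {ω | fPValue e q (Γ (X ω)) (X ω) (Y ω) (Z ω) ≤ α} ∪
        ({ω | ((X ω, Z ω), ε ω) ∈ (exceedance n e q f (-ζ + δ'))ᶜ} ∪
        {ω | (X ω, Z ω) ∉ regularDesigns n e q f σ A η ∩ strongDesigns n e q f σ (θ - η)}) := by
      intro ω _
      by_cases hG : (X ω, Z ω) ∈ regularDesigns n e q f σ A η ∩ strongDesigns n e q f σ (θ - η)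
      · by_cases hE : ((X ω, Z ω), ε ω) ∈ exceedance n e q f (-ζ + δ')
        · left
          obtain ⟨r1, r2, r3, -⟩ := regularDesigns_mono σ hA₁ hη₁' hG.1
          refine (hrej e q (X ω) (Z ω) (Y ω) (hΓ (X ω)) r1 r2 r3).1 ?_
          rw [hY]
          exact hE
        · exact Or.inr (Or.inl hE)
      · exact Or.inr (Or.inr hG)
    have h2 := (measureReal_mono (μ := P) hsub).trans ((measureReal_union_le _ _).trans
      (add_le_add le_rfl (measureReal_union_le _ _)))
    rw [probReal_univ] at h2
    linarith

end RandomDesign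

/-! ### The approximation error of the full model -/

section Approximation

variable {𝒳 : Type*} {n H : ℕ} {e : ℕ → 𝒳 → ℝ} {q : ℕ} {f : Fin H → 𝒳 → ℝ}

/-- Any groupwise fit bounds the distance to the full space. Enlarging the error at `i` from the
group `z i` to a sum over all groups removes the dependence on `z`, so that only the marginal law of
each `X_i` enters the expectation. -/
lemma norm_sq_residual_meanVec_le (x : Fin n → 𝒳) (z : Fin n → Fin H) (b : Fin H → Fin q → ℝ) :
    ‖(fullSpace e q x z)ᗮ.starProjection (WithLp.toLp 2 (meanVec f x z))‖ ^ 2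
      ≤ ∑ i, ∑ h, (f h (x i) - ∑ j, b h j * e j (x i)) ^ 2 := by
  set v : EuclideanSpace ℝ (Fin n) := WithLp.toLp 2 (meanVec f x z)
  set w : EuclideanSpace ℝ (Fin n) :=
    Matrix.toEuclideanLin (fullDesign e q x z) (WithLp.toLp 2 fun hj => b hj.1 hj.2) with hw
  have h1 : ‖(fullSpace e q x z)ᗮ.starProjection v‖ ≤ ‖v - w‖ := by
    rw [Submodule.starProjection_orthogonal_val, Submodule.starProjection_minimal]
    exact ciInf_le ⟨0, by rintro _ ⟨_, rfl⟩; positivity⟩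
      (⟨w, LinearMap.mem_range_self _ _⟩ : fullSpace e q x z)
  have hwi (i : Fin n) : w i = ∑ j, b (z i) j * e j (x i) := by
    rw [hw, Matrix.ofLp_toLpLin, Matrix.toLin'_apply]
    simp [Matrix.mulVec, dotProduct, fullDesign, Fintype.sum_prod_type, mul_comm]
  calc _ ≤ ‖v - w‖ ^ 2 := by gcongr
    _ = ∑ i, (f (z i) (x i) - ∑ j, b (z i) j * e j (x i)) ^ 2 := by
        rw [EuclideanSpace.norm_sq_eq]
        refine Finset.sum_congr rfl fun i _ => ?_
        rw [Real.norm_eq_abs, sq_abs, PiLp.sub_apply, hwi]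
        rfl
    _ ≤ _ := Finset.sum_le_sum fun i _ =>
        Finset.single_le_sum (f := fun h => (f h (x i) - ∑ j, b h j * e j (x i)) ^ 2)
          (fun _ _ => sq_nonneg _) (Finset.mem_univ _)

variable [MeasurableSpace 𝒳] {μ : Measure 𝒳}

lemma approxError_nonneg (g : 𝒳 → ℝ) : 0 ≤ approxError μ e g q :=
  Real.iInf_nonneg fun _ => integral_nonneg fun _ => sq_nonneg _

/-- Markov bound for the residual of the mean vector. -/
lemma residual_meanVec_markov {Ω : Type*} [MeasurableSpace Ω] {P : Measure Ω}
    [IsProbabilityMeasure P] {σ : ℝ≥0} {X : Ω → Fin n → 𝒳} {Y : Ω → Fin n → ℝ}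
    {Z : Ω → Fin n → Fin H} {ε : Ω → Fin n → ℝ} (hS : IsSampleH1 P μ f σ X Y Z ε)
    (he : ∀ j, MemLp (e j) 2 μ) (hf : ∀ h, MemLp (f h) 2 μ) {τ r : ℝ} (hτ : 0 < τ) (hr : 0 < r) :
    r * P.real {ω | r ≤ ‖(fullSpace e q (X ω) (Z ω))ᗮ.starProjection
        (WithLp.toLp 2 (meanVec f (X ω) (Z ω)))‖ ^ 2}
      ≤ n * ∑ h, approxError μ e (f h) q + τ := by
  -- Near-minimizers replace minimizers in `r(f; q)`; the total slack `nHs` stays below `τ`, and the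
  -- `+ 1` keeps the denominator positive.
  set s := τ / (n * H + 1)
  have hs : 0 < s := by positivity
  have hb (h : Fin H) : ∃ b : Fin q → ℝ,
      ∫ x, (f h x - ∑ j, b j * e j x) ^ 2 ∂μ < approxError μ e (f h) q + s :=
    exists_lt_of_ciInf_lt (lt_add_of_pos_right _ hs)
  choose b hb using hb
  set φ : Fin H → 𝒳 → ℝ := fun h x => (f h x - ∑ j, b h j * e j x) ^ 2
  have hφ (h : Fin H) : Integrable (φ h) μ :=
    ((hf h).sub (memLp_finsetSum _ (f := fun (j : Fin q) x => b h j * e j x)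
      fun j _ => (he j).const_mul (b h j))).integrable_sq
  have hXi (i : Fin n) : Measurable fun ω => X ω i := (measurable_pi_apply i).comp hS.measurable_X
  have hφX (h : Fin H) (i : Fin n) : Integrable (fun ω => φ h (X ω i)) P := by
    have := hφ h
    rw [← hS.law_X i] at this
    exact this.comp_measurable (hXi i)
  have integ (h : Fin H) (i : Fin n) : ∫ ω, φ h (X ω i) ∂P = ∫ x, φ h x ∂μ := by
    have := hφ h
    rw [← hS.law_X i] at this ⊢
    rw [integral_map (hXi i).aemeasurable this.aestronglyMeasurable]
  have hQ : Integrable (fun ω => ∑ i, ∑ h, φ h (X ω i)) P :=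
    integrable_finsetSum _ fun i _ => integrable_finsetSum _ fun h _ => hφX h i
  have hmarkov := mul_meas_ge_le_integral_of_nonneg (μ := P)
    (ae_of_all _ fun ω => Finset.sum_nonneg fun i _ => Finset.sum_nonneg fun h _ =>
      sq_nonneg _) hQ r
  calc _ ≤ r * P.real {ω | r ≤ ∑ i, ∑ h, φ h (X ω i)} := by
        refine mul_le_mul_of_nonneg_left (measureReal_mono fun ω hω => ?_) hr.le
        exact le_trans hω (norm_sq_residual_meanVec_le (X ω) (Z ω) b)
    _ ≤ ∫ ω, ∑ i, ∑ h, φ h (X ω i) ∂P := hmarkov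
    _ = ∑ _i : Fin n, ∑ h, ∫ x, φ h x ∂μ := by
        rw [integral_finsetSum _ fun i _ => integrable_finsetSum _ fun h _ => hφX h i]
        refine Finset.sum_congr rfl fun i _ => ?_
        rw [integral_finsetSum _ fun h _ => hφX h i]
        exact Finset.sum_congr rfl fun h _ => integ h i
    _ ≤ ∑ _i : Fin n, ∑ h, (approxError μ e (f h) q + s) := by
        exact Finset.sum_le_sum fun i _ => Finset.sum_le_sum fun h _ => (hb h).le
    _ = n * ∑ h, approxError μ e (f h) q + n * H * s := by
        simp [Finset.sum_add_distrib, mul_assoc]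
    _ ≤ _ := by
        have : (n * H + 1) * s = τ := mul_div_cancel₀ _ (by positivity)
        nlinarith

end Approximation

lemma tendsto_real_of_tendsto {Ω : ℕ → Type*} [∀ n, MeasurableSpace (Ω n)]
    {P : ∀ n, Measure (Ω n)} {s : ∀ n, Set (Ω n)}
    (h : Tendsto (fun n => P n (s n)) atTop (𝓝 0)) :
    Tendsto (fun n => (P n).real (s n)) atTop (𝓝 0) := by
  simpa using! (ENNReal.tendsto_toReal ENNReal.zero_ne_top).comp h

lemma tendsto_zero_of_forall_le {u : ℕ → ℝ} (h0 : ∀ n, 0 ≤ u n)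
    (h : ∀ ξ > 0, ∃ v : ℕ → ℝ, Tendsto v atTop (𝓝 0) ∧ ∀ᶠ n in atTop, u n ≤ v n + ξ) :
    Tendsto u atTop (𝓝 0) := by
  refine tendsto_order.2 ⟨fun a ha => .of_forall fun n => ha.trans_le (h0 n), fun a ha => ?_⟩
  obtain ⟨v, hv, huv⟩ := h (a / 2) (half_pos ha)
  filter_upwards [huv, hv.eventually_lt_const (half_pos ha)] with n h1 h2
  linarith

/-! ### Asymptotics of the random designs -/

lemma signal_lt_iff {𝒳 : Type*} {n H q : ℕ} {e : ℕ → 𝒳 → ℝ} {f : Fin H → 𝒳 → ℝ} {σ : ℝ≥0}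
    {x : Fin n → 𝒳} {z : Fin n → Fin H} (hσ : 0 < σ)
    (ha : 0 < Module.finrank ℝ (diffSpace e q x z)) (s : ℝ) :
    signal e q f σ x z < s ↔
      ‖(diffSpace e q x z).starProjection (WithLp.toLp 2 (meanVec f x z))‖ ^ 2
      + ‖(fullSpace e q x z)ᗮ.starProjection (WithLp.toLp 2 (meanVec f x z))‖ ^ 2 <
      s * ((σ : ℝ) ^ 2 * √(Module.finrank ℝ (diffSpace e q x z))) := by
  rw [signal_eq, div_lt_iff₀]
  have : (0 : ℝ) < Module.finrank ℝ (diffSpace e q x z) := by exact_mod_cast ha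
  positivity

section Asymptotics

variable {𝒳 : Type*} [MeasurableSpace 𝒳] {H : ℕ} {μ : Measure 𝒳} {e : ℕ → 𝒳 → ℝ} {q : ℕ → ℕ}
  {f : ℕ → Fin H → 𝒳 → ℝ} {σ : ℝ≥0} {Ω : ℕ → Type*} [∀ n, MeasurableSpace (Ω n)]
  {P : ∀ n, Measure (Ω n)} [∀ n, IsProbabilityMeasure (P n)] {X : ∀ n, Ω n → Fin n → 𝒳}
  {Y : ∀ n, Ω n → Fin n → ℝ} {Z : ∀ n, Ω n → Fin n → Fin H} {ε : ∀ n, Ω n → Fin n → ℝ}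

/-- The numerator `S` of the approximation condition is deterministic. Markov's inequality at level
`(S + τ)/ξ` leaves probability at most `ξ`, and with high probability that level is below `ησ²√a`
when `a > 1`. -/
lemma tendsto_large_residual (he : ∀ j, MemLp (e j) 2 μ) (hf : ∀ n h, MemLp (f n h) 2 μ)
    (hσ : 0 < σ) (hS : ∀ n, IsSampleH1 (P n) μ (f n) σ (X n) (Y n) (Z n) (ε n))
    (happrox : TendstoInPr P (fun n ω => (n * ∑ h : Fin H, approxError μ e (f n h) (q n)) /
      √((p1 e (q n) (X n ω) (Z n ω) : ℝ) - p0 e (q n) (X n ω))) 0) {η : ℝ} (hη : 0 < η) :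
    Tendsto (fun n => (P n).real {ω |
      (1 : ℝ) < Module.finrank ℝ (diffSpace e (q n) (X n ω) (Z n ω)) ∧
      η * ((σ : ℝ) ^ 2 * √(Module.finrank ℝ (diffSpace e (q n) (X n ω) (Z n ω)))) <
        ‖(fullSpace e (q n) (X n ω) (Z n ω))ᗮ.starProjection
          (WithLp.toLp 2 (meanVec (f n) (X n ω) (Z n ω)))‖ ^ 2}) atTop (𝓝 0) := by
  refine tendsto_zero_of_forall_le (fun n => by positivity) fun ξ hξ => ?_
  have hσ' : (0 : ℝ) < (σ : ℝ) ^ 2 := by positivity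
  -- Half of the allowance `ξησ²√a` is for `S`, half for `τ`; the latter uses `√a ≥ 1`.
  set ξ₀ := ξ * (η * (σ : ℝ) ^ 2) / 2 with hξ₀def
  have hξ₀ : 0 < ξ₀ := by positivity
  refine ⟨_, tendsto_real_of_tendsto (happrox ξ₀ hξ₀), ?_⟩
  filter_upwards [tendsto_one_div_add_atTop_nhds_zero_nat.eventually_le_const hξ₀] with n hn
  set S : ℝ := n * ∑ h : Fin H, approxError μ e (f n h) (q n)
  have hS0 : 0 ≤ S := by
    have := Finset.sum_nonneg (s := Finset.univ)
      fun h _ => approxError_nonneg (μ := μ) (e := e) (q := q n) (f n h)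
    positivity
  set τ : ℝ := 1 / ((n : ℝ) + 1)
  have hτ : 0 < τ := by positivity
  have hmk := residual_meanVec_markov (q := q n) (hS n) he (hf n) hτ (r := (S + τ) / ξ)
    (by positivity)
  rw [div_mul_eq_mul_div, div_le_iff₀ hξ] at hmk
  have hmk' := le_of_mul_le_mul_left hmk (by positivity)
  refine (measureReal_mono (fun ω hω => ?_)).trans
    ((measureReal_union_le _ _).trans (add_le_add le_rfl hmk'))
  obtain ⟨h1, h2⟩ := hω
  by_cases hbig : ξ₀ ≤ |S / √((p1 e (q n) (X n ω) (Z n ω) : ℝ) - p0 e (q n) (X n ω)) - 0|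
  · exact Or.inl hbig
  · refine Or.inr (le_trans ?_ h2.le)
    rw [← finrank_diffSpace, sub_zero, not_le] at hbig
    set a : ℝ := (Module.finrank ℝ (diffSpace e (q n) (X n ω) (Z n ω)) : ℝ)
    have hr : 1 ≤ √a := Real.one_le_sqrt.2 h1.le
    have h3 := lt_of_abs_lt hbig
    rw [div_lt_iff₀ (by linarith)] at h3
    rw [div_le_iff₀ hξ]
    nlinarith

lemma tendsto_irregular (he : ∀ j, MemLp (e j) 2 μ) (hf : ∀ n h, MemLp (f n h) 2 μ)
    (hσ : 0 < σ) (hS : ∀ n, IsSampleH1 (P n) μ (f n) σ (X n) (Y n) (Z n) (ε n))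
    (hdiv : TendstoTopInPr P (fun n ω =>
      (p1 e (q n) (X n ω) (Z n ω) : ℝ) - p0 e (q n) (X n ω)))
    (hpos : Tendsto (fun n => P n {ω | n ≤ p1 e (q n) (X n ω) (Z n ω)}) atTop (𝓝 0))
    (hratio : TendstoInPr P (fun n ω =>
      ((p1 e (q n) (X n ω) (Z n ω) : ℝ) - p0 e (q n) (X n ω)) /
        ((n : ℝ) - p1 e (q n) (X n ω) (Z n ω))) 0)
    (happrox : TendstoInPr P (fun n ω => (n * ∑ h : Fin H, approxError μ e (f n h) (q n)) /
      √((p1 e (q n) (X n ω) (Z n ω) : ℝ) - p0 e (q n) (X n ω))) 0) (A : ℕ) {η : ℝ} (hη : 0 < η) :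
    Tendsto (fun n => (P n).real
      {ω | (X n ω, Z n ω) ∉ regularDesigns n e (q n) (f n) σ A η}) atTop (𝓝 0) := by
  have l1 := tendsto_real_of_tendsto (hdiv (max A 1))
  have l2 := tendsto_real_of_tendsto hpos
  have l3 := tendsto_real_of_tendsto (hratio η hη)
  have l4 := tendsto_large_residual he hf hσ hS happrox hη
  have l := (l1.add l2).add (l3.add l4)
  simp only [add_zero] at l
  refine squeeze_zero (fun n => by positivity) (fun n => ?_) l
  refine le_trans (measureReal_mono (fun ω hω => ?_)) ((measureReal_union_le _ _).trans
    (add_le_add (measureReal_union_le _ _) (measureReal_union_le _ _)))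
  by_contra hcon
  simp only [Set.mem_union, Set.mem_ofPred_eq, not_or, not_le, sub_zero, ← finrank_diffSpace,
    max_lt_iff, not_and] at hcon
  obtain ⟨⟨⟨c1, c1'⟩, c2⟩, c3, c4⟩ := hcon
  refine hω ⟨by exact_mod_cast c1.le, by exact_mod_cast one_pos.trans c1', ?_, not_lt.1 (c4 c1')⟩
  -- If `p₁ = n` the quotient is zero by convention and says nothing about `a`; positivity is needed
  -- to clear the denominator.
  have hb : (0 : ℝ) < (n : ℝ) - p1 e (q n) (X n ω) (Z n ω) := by
    rw [sub_pos]; exact_mod_cast c2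
  rw [finrank_residualSpace]
  have := lt_of_abs_lt c3
  rw [div_lt_iff₀ hb] at this
  exact this.le

end Asymptotics

end PartialPerm

end

/-! ### Passage to the limit. -/

theorem theorem7 {d H : ℕ} (_hH : 2 ≤ H)
    -- distribution of the covariates, basis functions, feature dimensions, regression functions
    (μ : Measure (EuclideanSpace ℝ (Fin d))) [IsProbabilityMeasure μ]
    (e : ℕ → EuclideanSpace ℝ (Fin d) → ℝ)
    (_he : ∀ j, Measurable (e j)) (_he2 : ∀ j, MemLp (e j) 2 μ)
    (q : ℕ → ℕ)
    (f : ℕ → Fin H → EuclideanSpace ℝ (Fin d) → ℝ)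
    (_hf : ∀ n h, Measurable (f n h)) (_hf2 : ∀ n h, MemLp (f n h) 2 μ)
    (σ₀ : ℝ≥0) (_hσ₀ : 0 < σ₀)
    -- for each sample size `n`, a sample from the alternative model
    {Ω : ℕ → Type*} [∀ n, MeasurableSpace (Ω n)]
    (P : ∀ n, Measure (Ω n)) [∀ n, IsProbabilityMeasure (P n)]
    (X : ∀ n, Ω n → Fin n → EuclideanSpace ℝ (Fin d))
    (Y : ∀ n, Ω n → Fin n → ℝ) (Z : ∀ n, Ω n → Fin n → Fin H) (ε : ∀ n, Ω n → Fin n → ℝ)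
    (_hsample : ∀ n, PartialPerm.IsSampleH1 (P n) μ (f n) σ₀ (X n) (Y n) (Z n) (ε n))
    -- any eigendecomposition of the kernel matrices, eigenvalues in descending order
    (Γ : ∀ n, (Fin n → EuclideanSpace ℝ (Fin d)) → Matrix (Fin n) (Fin n) ℝ)
    (c : ∀ n, (Fin n → EuclideanSpace ℝ (Fin d)) → Fin n → ℝ)
    (_hΓ : ∀ n x, PartialPerm.IsEigenDecomposition
      (PartialPerm.kernelMatrix (PartialPerm.kernel e (q n)) x) (Γ n x) (c n x))
    -- the asymptotic conditions
    (θ : ℝ) (_hθ : 0 ≤ θ)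
    (_hdiv : PartialPerm.TendstoTopInPr P (fun n ω =>
      (PartialPerm.p1 e (q n) (X n ω) (Z n ω) : ℝ) - PartialPerm.p0 e (q n) (X n ω)))
    (_hpos : Tendsto (fun n => P n {ω | n ≤ PartialPerm.p1 e (q n) (X n ω) (Z n ω)}) atTop (𝓝 0))
    (_hratio : PartialPerm.TendstoInPr P (fun n ω =>
      ((PartialPerm.p1 e (q n) (X n ω) (Z n ω) : ℝ) - PartialPerm.p0 e (q n) (X n ω)) /
        ((n : ℝ) - PartialPerm.p1 e (q n) (X n ω) (Z n ω))) 0)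
    (_happrox : PartialPerm.TendstoInPr P (fun n ω =>
      (n * ∑ h : Fin H, PartialPerm.approxError μ e (f n h) (q n)) /
        √((PartialPerm.p1 e (q n) (X n ω) (Z n ω) : ℝ) - PartialPerm.p0 e (q n) (X n ω))) 0)
    (α : ℝ) (_hα : α ∈ Set.Ioo (0 : ℝ) 1) :
    (PartialPerm.TendstoInPr P
        (fun n ω => PartialPerm.signal e (q n) (f n) σ₀ (X n ω) (Z n ω)) θ →
      Tendsto
        (fun n => (P n).real
          {ω | PartialPerm.fPValue e (q n) (Γ n (X n ω)) (X n ω) (Y n ω) (Z n ω) ≤ α})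
        atTop
        (𝓝 (PartialPerm.stdNormalCDF (PartialPerm.stdNormalQuantile α + θ / √2)))) ∧
    (PartialPerm.GeInPr P
        (fun n ω => PartialPerm.signal e (q n) (f n) σ₀ (X n ω) (Z n ω)) θ →
      ∃ ρ : ℕ → ℝ, Tendsto ρ atTop (𝓝 0) ∧
        ∀ n, PartialPerm.stdNormalCDF (PartialPerm.stdNormalQuantile α + θ / √2) + ρ n ≤
          (P n).real
            {ω | PartialPerm.fPValue e (q n) (Γ n (X n ω)) (X n ω) (Y n ω) (Z n ω) ≤ α}) := by
  set Φ := PartialPerm.stdNormalCDF (PartialPerm.stdNormalQuantile α + θ / √2)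
  set R : ℕ → ℝ := fun n => (P n).real
    {ω | PartialPerm.fPValue e (q n) (Γ n (X n ω)) (X n ω) (Y n ω) (Z n ω) ≤ α}
  have hirr := fun A {η : ℝ} (hη : 0 < η) =>
    PartialPerm.tendsto_irregular _he2 _hf2 _hσ₀ _hsample _hdiv _hpos _hratio _happrox A hη
  have hlower (hsig : ∀ η > 0, Tendsto (fun n => (P n).real {ω |
      PartialPerm.signal e (q n) (f n) σ₀ (X n ω) (Z n ω) < θ - η}) atTop (𝓝 0)) :
      ∀ δ > 0, ∀ᶠ n in atTop, Φ - δ < R n := by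
    intro δ hδ
    obtain ⟨A, η, hη, h⟩ := PartialPerm.rejection_probability
      (𝒳 := EuclideanSpace ℝ (Fin d)) (H := H) _hα θ (half_pos hδ)
    -- Strong designs concern only the `diffSpace` part of the signal; one half of `η` pays for the
    -- residual part and the other for the deviation of the signal from `θ`.
    have l := ((hirr A (half_pos hη)).add (hsig (η / 2) (half_pos hη))).const_mul 2
    rw [add_zero, mul_zero] at l
    filter_upwards [l.eventually_lt_const (half_pos hδ)] with n hn
    have h2 := (h n e (q n) (f n) σ₀ _hσ₀ _he (_hf n) (P n) μ (X n) (Y n) (Z n) (ε n) (Γ n) (c n)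
      (_hsample n) (_hΓ n)).2
    have h3 : (P n).real {ω | (X n ω, Z n ω) ∉
        PartialPerm.regularDesigns n e (q n) (f n) σ₀ A η ∩
          PartialPerm.strongDesigns n e (q n) (f n) σ₀ (θ - η)} ≤ _ :=
      (measureReal_mono (fun ω hω => ?_)).trans (measureReal_union_le
        {ω | (X n ω, Z n ω) ∉ PartialPerm.regularDesigns n e (q n) (f n) σ₀ A (η / 2)}
        {ω | PartialPerm.signal e (q n) (f n) σ₀ (X n ω) (Z n ω) < θ - η / 2})
    · simp only [R]
      linarith
    · by_contra hcon
      simp only [Set.mem_union, Set.mem_ofPred_eq, not_or, not_not] at hcon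
      obtain ⟨hreg, hs⟩ := hcon
      refine hω ⟨PartialPerm.regularDesigns_mono σ₀ le_rfl (half_le_self hη.le) hreg, ?_⟩
      obtain ⟨-, ha, -, hW⟩ := hreg
      rw [PartialPerm.signal_lt_iff _hσ₀ ha, not_lt] at hs
      simp only [PartialPerm.strongDesigns, Set.mem_ofPred_eq]
      linarith
  have hupper (hsig : ∀ η > 0, Tendsto (fun n => (P n).real {ω |
      ¬ PartialPerm.signal e (q n) (f n) σ₀ (X n ω) (Z n ω) < θ + η}) atTop (𝓝 0)) :
      ∀ δ > 0, ∀ᶠ n in atTop, R n < Φ + δ := by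
    intro δ hδ
    obtain ⟨A, η, hη, h⟩ := PartialPerm.rejection_probability
      (𝒳 := EuclideanSpace ℝ (Fin d)) (H := H) _hα θ (half_pos hδ)
    have l := ((hirr A hη).add (hsig η hη)).const_mul 2
    rw [add_zero, mul_zero] at l
    filter_upwards [l.eventually_lt_const (half_pos hδ)] with n hn
    have h2 := (h n e (q n) (f n) σ₀ _hσ₀ _he (_hf n) (P n) μ (X n) (Y n) (Z n) (ε n) (Γ n) (c n)
      (_hsample n) (_hΓ n)).1
    have h3 : (P n).real {ω | (X n ω, Z n ω) ∉
        PartialPerm.regularDesigns n e (q n) (f n) σ₀ A η ∩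
          PartialPerm.weakDesigns n e (q n) (f n) σ₀ (θ + η)} ≤ _ :=
      (measureReal_mono (fun ω hω => ?_)).trans (measureReal_union_le
        {ω | (X n ω, Z n ω) ∉ PartialPerm.regularDesigns n e (q n) (f n) σ₀ A η}
        {ω | ¬ PartialPerm.signal e (q n) (f n) σ₀ (X n ω) (Z n ω) < θ + η})
    · simp only [R]
      linarith
    · by_contra hcon
      simp only [Set.mem_union, Set.mem_ofPred_eq, not_or, not_not] at hcon
      obtain ⟨hreg, hs⟩ := hcon
      refine hω ⟨hreg, ?_⟩
      obtain ⟨-, ha, -, -⟩ := hreg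
      rw [PartialPerm.signal_lt_iff _hσ₀ ha] at hs
      simp only [PartialPerm.weakDesigns, Set.mem_ofPred_eq]
      -- For an upper bound the residual part is simply dropped, so `η` is not halved.
      exact le_trans (le_add_of_nonneg_right (by positivity)) hs.le
  constructor
  · intro hsig
    have hlow := hlower fun η hη => by
      refine squeeze_zero (fun n => by positivity) (fun n => measureReal_mono fun ω hω => ?_)
        (PartialPerm.tendsto_real_of_tendsto (hsig η hη))
      have : PartialPerm.signal e (q n) (f n) σ₀ (X n ω) (Z n ω) < θ - η := hω
      change η ≤ |PartialPerm.signal e (q n) (f n) σ₀ (X n ω) (Z n ω) - θ|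
      exact le_abs.2 (Or.inr (by linarith))
    have hup := hupper fun η hη => by
      refine squeeze_zero (fun n => by positivity) (fun n => measureReal_mono fun ω hω => ?_)
        (PartialPerm.tendsto_real_of_tendsto (hsig η hη))
      have : θ + η ≤ PartialPerm.signal e (q n) (f n) σ₀ (X n ω) (Z n ω) := not_lt.1 hω
      change η ≤ |PartialPerm.signal e (q n) (f n) σ₀ (X n ω) (Z n ω) - θ|
      exact le_abs.2 (Or.inl (by linarith))
    refine tendsto_order.2 ⟨fun r hr => ?_, fun r hr => ?_⟩
    · filter_upwards [hlow (Φ - r) (sub_pos.2 hr)] with n hn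
      linarith
    · filter_upwards [hup (r - Φ) (sub_pos.2 hr)] with n hn
      linarith
  · rintro ⟨D, hD, hDs⟩
    have hlow := hlower fun η hη => by
      refine squeeze_zero (fun n => by positivity) (fun n => measureReal_mono fun ω hω => ?_)
        (PartialPerm.tendsto_real_of_tendsto (hD η hη))
      have : PartialPerm.signal e (q n) (f n) σ₀ (X n ω) (Z n ω) < θ - η := hω
      have hDω : θ + D n ω ≤ PartialPerm.signal e (q n) (f n) σ₀ (X n ω) (Z n ω) := hDs n ω
      change η ≤ |D n ω - 0|
      exact le_abs.2 (Or.inr (by linarith))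
    -- Truncation at zero discards any excess of power, leaving only the deficit, which vanishes by
    -- the lower bound.
    refine ⟨fun n => min 0 (R n - Φ), ?_, fun n => ?_⟩
    · refine tendsto_order.2 ⟨fun r hr => ?_, fun r hr => .of_forall fun n =>
        (min_le_left _ _).trans_lt hr⟩
      filter_upwards [hlow (-r) (neg_pos.2 hr)] with n hn
      exact lt_min hr (by linarith)
    · have := min_le_right 0 (R n - Φ)
      linarith
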